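/- Let $p$ be a prime and let $(R,\mathfrak m)$ be a complete Noetherian local ring of characteristic $p$ which is $F$-finite, i.e. the Frobenius $R\to R$, $r\mapsto r^p$, is a finite ring homomorphism. Let $N$ be a cofinite (i.e. Artinian) $R$-module equipped with a $p$-linear map $F\colon N\to N$, i.e. $F$ is additive and $F(rx)=r^pF(x)$ for $r\in R$, $x\in N$. A submodule $N'\subseteq N$ is called $F$-stable if $F(N')\subseteq N'$; for $F$-stable submodules $N'\subseteq N''$ the quotient $N''/N'$ carries an induced action of $F$, and it is called $F$-nilpotent if some power of $F$ is zero on it. Then: (a) The ascending chain of submodules $\ker F\subseteq\ker F^2\subseteq\ker F^3\subseteq\cdots$ stabilizes. (b) Every chain $\cdots\subseteq N_i\subseteq N_{i+1}\subseteq N_{i+2}\subseteq\cdots$ ($i\in\mathbb Z$) of $F$-stable submodules of $N$ has eventually $F$-nilpotent quotients: $N_{i+1}/N_i$ is $F$-nilpotent for all $i$ with $|i|$ sufficiently large. (c) Up to nilpotent action of $F$, the module $N$ has only finitely many $F$-stable submodules: there are only finitely many classes of $F$-stable submodules for the equivalence relation in which $N_1\sim N_2$ if and only if $N_1/(N_1\cap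 N_2)$ and $N_2/(N_1\cap N_2)$ are both $F$-nilpotent. Concretely, there are only finitely many $F$-stable submodules $N'\subseteq N$ for which the induced action of $F$ on $N/N'$ is injective. -/

import Mathlib

namespace FrobeniusAction

universe u v

variable {R : Type u} [CommRing R] {p : ℕ} [ExpChar R p]
variable {N : Type v} [AddCommGroup N] [Module R N]

/-- `R` is `F`-finite: the Frobenius `r ↦ r ^ p` is a finite ring homomorphism. -/
def IsFFinite (R : Type u) [CommRing R] (p : ℕ) [ExpChar R p] : Prop :=
  (frobenius R p).Finite

/-- `ker (F ^ n)` as an `R`-submodule. A `p`-linear map (additive with `F (r • x) = r ^ p • F x`)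
is a semilinear map along the Frobenius of `R`. -/
def iterateKer (F : N →ₛₗ[frobenius R p] N) (n : ℕ) : Submodule R N where
  carrier := {x | F^[n] x = 0}
  zero_mem' := by
    simp only [Set.mem_ofPred_eq]
    exact Function.iterate_fixed (map_zero F) n
  add_mem' := by
    intro a b ha hb
    simp only [Set.mem_ofPred_eq] at *
    rw [iterate_map_add, ha, hb, add_zero]
  smul_mem' := by
    intro c x hx
    simp only [Set.mem_ofPred_eq] at *
    induction n generalizing c x with
    | zero => simp_all
    | succ n ih =>
      rw [Function.iterate_succ_apply, map_smulₛₗ]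
      exact ih _ (by rwa [Function.iterate_succ_apply] at hx)

/-- The submodule `P` is stable under `F`. -/
def IsFStable (F : N →ₛₗ[frobenius R p] N) (P : Submodule R N) : Prop :=
  ∀ x ∈ P, F x ∈ P

/-- The type of `F`-stable submodules of `N`, ordered by inclusion. -/
abbrev FStableSubmodule (F : N →ₛₗ[frobenius R p] N) : Type v :=
  {P : Submodule R N // IsFStable F P}

/-- The action of `F` on an `F`-stable submodule. -/
def restrictMap (F : N →ₛₗ[frobenius R p] N) (P : Submodule R N) (hP : IsFStable F P) :
    P →ₛₗ[frobenius R p] P where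
  toFun x := ⟨F x, hP x x.2⟩
  map_add' x y := by ext; simp
  map_smul' r x := by ext; simp

/-- The action of `F` on the quotient by an `F`-stable submodule. -/
def quotientMap (F : N →ₛₗ[frobenius R p] N) (P : Submodule R N) (hP : IsFStable F P) :
    (N ⧸ P) →ₛₗ[frobenius R p] (N ⧸ P) :=
  P.mapQ P F hP

/-- The action of `F` is nilpotent: some power of `F` is zero. -/
def IsFNilpotent (F : N →ₛₗ[frobenius R p] N) : Prop :=
  ∃ e : ℕ, ∀ x : N, F^[e] x = 0

theorem IsFStable.submoduleOf {F : N →ₛₗ[frobenius R p] N} {P Q : Submodule R N}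
    (hP : IsFStable F P) (hQ : IsFStable F Q) :
    IsFStable (restrictMap F Q hQ) (P.submoduleOf Q) :=
  fun x hx => hP x hx

theorem IsFStable.inf {F : N →ₛₗ[frobenius R p] N} {P Q : Submodule R N}
    (hP : IsFStable F P) (hQ : IsFStable F Q) : IsFStable F (P ⊓ Q) :=
  fun x hx => ⟨hP x hx.1, hQ x hx.2⟩

/-- The quotient `Q / P` of `F`-stable submodules, with its induced action of `F`, is
`F`-nilpotent. (Used for `P ≤ Q`.) -/
def NilpotentQuotient (F : N →ₛₗ[frobenius R p] N) (P Q : FStableSubmodule F) : Prop :=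
  IsFNilpotent (quotientMap (restrictMap F Q.1 Q.2) (P.1.submoduleOf Q.1) (P.2.submoduleOf Q.2))

theorem nilpotentQuotient_iff (F : N →ₛₗ[frobenius R p] N) (P Q : FStableSubmodule F) :
    NilpotentQuotient F P Q ↔ ∃ e : ℕ, ∀ x ∈ Q.1, F^[e] x ∈ P.1 := by
  have h1 : ∀ (e : ℕ) (x : Q.1),
      (((restrictMap F Q.1 Q.2)^[e] x : Q.1) : N) = F^[e] (x : N) := by
    intro e
    induction e with
    | zero => intro x; rfl
    | succ e ih => intro x; rw [Function.iterate_succ_apply, Function.iterate_succ_apply, ih]; rfl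
  have h2 : ∀ (e : ℕ) (x : Q.1),
      (quotientMap (restrictMap F Q.1 Q.2) (P.1.submoduleOf Q.1) (P.2.submoduleOf Q.2))^[e]
        (Submodule.Quotient.mk x) = Submodule.Quotient.mk ((restrictMap F Q.1 Q.2)^[e] x) := by
    intro e
    induction e with
    | zero => intro x; rfl
    | succ e ih => intro x; rw [Function.iterate_succ_apply, Function.iterate_succ_apply, ← ih]; rfl
  have h3 : ∀ (e : ℕ) (x : Q.1),
      (quotientMap (restrictMap F Q.1 Q.2) (P.1.submoduleOf Q.1) (P.2.submoduleOf Q.2))^[e]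
        (Submodule.Quotient.mk x) = 0 ↔ F^[e] (x : N) ∈ P.1 := by
    intro e x
    rw [h2, Submodule.Quotient.mk_eq_zero, ← h1]; rfl
  constructor
  · rintro ⟨e, he⟩
    exact ⟨e, fun x hx => (h3 e ⟨x, hx⟩).1 (he _)⟩
  · rintro ⟨e, he⟩
    refine ⟨e, fun y => ?_⟩
    obtain ⟨x, rfl⟩ := Submodule.Quotient.mk_surjective _ y
    exact (h3 e x).2 (he x x.2)

/-- Two `F`-stable submodules agree up to nilpotent action of `F`: both `P / (P ∩ Q)` and
`Q / (P ∩ Q)` are `F`-nilpotent, i.e. both inclusions of `P ∩ Q` are nil-isomorphisms. -/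
def NilEquiv (F : N →ₛₗ[frobenius R p] N) (P Q : FStableSubmodule F) : Prop :=
  NilpotentQuotient F ⟨P.1 ⊓ Q.1, P.2.inf Q.2⟩ P ∧
    NilpotentQuotient F ⟨P.1 ⊓ Q.1, P.2.inf Q.2⟩ Q

theorem IsFStable.iterate_mem {F : N →ₛₗ[frobenius R p] N} {P : Submodule R N}
    (hP : IsFStable F P) (e : ℕ) {x : N} (hx : x ∈ P) : F^[e] x ∈ P := by
  induction e generalizing x with
  | zero => exact hx
  | succ e ih => rw [Function.iterate_succ_apply]; exact ih (hP x hx)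

theorem nilEquiv_iff (F : N →ₛₗ[frobenius R p] N) (P Q : FStableSubmodule F) :
    NilEquiv F P Q ↔
      (∃ e : ℕ, ∀ x ∈ P.1, F^[e] x ∈ Q.1) ∧ (∃ e : ℕ, ∀ x ∈ Q.1, F^[e] x ∈ P.1) := by
  unfold NilEquiv
  rw [nilpotentQuotient_iff, nilpotentQuotient_iff]
  constructor
  · rintro ⟨⟨a, ha⟩, ⟨b, hb⟩⟩
    exact ⟨⟨a, fun x hx => (ha x hx).2⟩, ⟨b, fun x hx => (hb x hx).1⟩⟩
  · rintro ⟨⟨a, ha⟩, ⟨b, hb⟩⟩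
    exact ⟨⟨a, fun x hx => ⟨P.2.iterate_mem a hx, ha x hx⟩⟩,
      ⟨b, fun x hx => ⟨hb x hx, Q.2.iterate_mem b hx⟩⟩⟩

theorem nilEquiv_equivalence (F : N →ₛₗ[frobenius R p] N) : Equivalence (NilEquiv F) where
  refl P := (nilEquiv_iff F P P).2 ⟨⟨0, fun _ hx => hx⟩, ⟨0, fun _ hx => hx⟩⟩
  symm {P Q} h := (nilEquiv_iff F Q P).2 ((nilEquiv_iff F P Q).1 h).symm
  trans {P Q S} h h' := by
    obtain ⟨⟨a, ha⟩, ⟨b, hb⟩⟩ := (nilEquiv_iff F P Q).1 h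
    obtain ⟨⟨c, hc⟩, ⟨d, hd⟩⟩ := (nilEquiv_iff F Q S).1 h'
    refine (nilEquiv_iff F P S).2 ⟨⟨c + a, fun x hx => ?_⟩, ⟨b + d, fun x hx => ?_⟩⟩
    · rw [Function.iterate_add_apply]; exact hc _ (ha x hx)
    · rw [Function.iterate_add_apply]; exact hb _ (hd x hx)

/-- Equality of `F`-stable submodules up to nilpotent action of `F`. -/
def nilSetoid (F : N →ₛₗ[frobenius R p] N) : Setoid (FStableSubmodule F) :=
  ⟨NilEquiv F, nilEquiv_equivalence F⟩

end FrobeniusAction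

/-! Call an `F`-stable submodule special if `F` is injective modulo it (`IsSpecial`). The elements
that some power of `F` carries into a stable submodule `P` form a special submodule, `nilClosure`.
By the Hartshorne–Speiser–Lyubeznik theorem (`exists_iterateKer_le`), applied to `N / P`, a single
power works for the whole closure, so `P` agrees with its closure up to nilpotents. The claims thus
reduce to that theorem and to the special submodules: these satisfy ACC and DCC, and each has
finitely many covers, hence there are finitely many of them.

DCC is inherited from `N`. ACC (`wellFounded_gt_isSpecial`) is proved by Noetherian induction on an
ideal multiplying the chain into its first term. At a prime `P` two facts are used: the primes that
are annihilators of stable submodules modulo a special one are finite in number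
(`finite_stablePrimes`), and the Matlis dual of `N` is Noetherian, so a chain cannot have infinitely
many steps that are faithful over `R / P` (`exists_smul_le_of_isPrime`). The latter fact also drives
the Hartshorne–Speiser–Lyubeznik theorem.

Covers of a special `L` come from minimal stable submodules of `N / L`. Finitely many minimal ones
have a sum containing all the others, and each of the others is the image of one of these under an
`F`-equivariant map. There are finitely many such maps (`finite_equivariantHom`): they embed in a
Noetherian module of homomorphisms, and the coefficients of a linear relation between them are, up
to a common factor, fixed by Frobenius, hence lie in the prime field. -/

open Submodule IsLocalRing

/-! ### Injective hulls of the residue field and finiteness over complete rings -/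

section MatlisDuality

universe u v w

variable {R : Type u} [CommRing R]

/-- Evaluation at `1` identifies `R`-linear maps into the character module of `R` with characters,
and characters extend because `ℚ/ℤ` is divisible. -/
theorem CharacterModule.baer (R : Type u) [CommRing R] : Module.Baer R (CharacterModule R) := by
  intro I g
  let c : CharacterModule I :=
    AddMonoidHom.mk' (fun i => g i 1) (fun a b => by rw [map_add]; rfl)
  obtain ⟨d, hd⟩ := CharacterModule.dual_surjective_of_injective I.subtype
    I.injective_subtype c
  refine ⟨LinearMap.toSpanSingleton R _ d, fun x hx => ?_⟩
  ext s
  have h1 : d (x * s) = c (s • ⟨x, hx⟩) := by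
    rw [← hd]
    change d (x * s) = d (s * x)
    rw [mul_comm]
  have h2 : c (s • ⟨x, hx⟩) = g ⟨x, hx⟩ s := by
    change g (s • ⟨x, hx⟩) 1 = _
    rw [map_smul, CharacterModule.smul_apply, smul_eq_mul, mul_one]
  rw [LinearMap.toSpanSingleton_apply, CharacterModule.smul_apply, smul_eq_mul, h1, h2]

/-- Over a Baer module, a map factors through any map with smaller kernel. -/
theorem Module.Baer.exists_comp_eq {E : Type w} [AddCommGroup E] [Module R E]
    (hE : Module.Baer R E) {A B : Type*} [AddCommGroup A] [Module R A] [AddCommGroup B] [Module R B]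
    (f : A →ₗ[R] B) (g : A →ₗ[R] E) (h : LinearMap.ker f ≤ LinearMap.ker g) :
    ∃ k : B →ₗ[R] E, ∀ a, k (f a) = g a := by
  obtain ⟨k, hk⟩ := hE.extension_property ((LinearMap.ker f).liftQ f le_rfl)
    (LinearMap.ker_eq_bot.1 (Submodule.ker_liftQ_eq_bot _ _ _ le_rfl))
    ((LinearMap.ker f).liftQ g h)
  exact ⟨k, fun a => congr($hk ((LinearMap.ker f).mkQ a))⟩

/-- `E` is an injective module whose socle is spanned by `e` and is a copy of the residue field. -/
structure IsMatlisModule (R : Type u) [CommRing R] [IsLocalRing R] 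
    {E : Type w} [AddCommGroup E] [Module R E] (e : E) :
    Prop where
  baer : Module.Baer R E
  ne_zero : e ≠ 0
  smul_eq_zero : ∀ r ∈ maximalIdeal R, r • e = 0
  mem_span : ∀ x : E, (∀ r ∈ maximalIdeal R, r • x = 0) → x ∈ R ∙ e

/-- A maximal essential extension `E` of a copy `R ∙ e` of the residue field inside the injective
module `CharacterModule R` is a direct summand, hence injective. Essentiality forces the socle of
`E` to be `R ∙ e`. -/
theorem exists_isMatlisModule (R : Type u) [CommRing R] [IsLocalRing R] :
    ∃ (E : Type u) (_ : AddCommGroup E) (_ : Module R E) (e : E), IsMatlisModule R e := by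
  obtain ⟨c, hc⟩ := CharacterModule.exists_character_apply_ne_zero_of_ne_zero
    (one_ne_zero (α := R ⧸ maximalIdeal R))
  set e : CharacterModule R := CharacterModule.dual (maximalIdeal R).mkQ c with he
  have he0 : e ≠ 0 := fun h => hc congr($h (1 : R))
  have hme : ∀ r ∈ maximalIdeal R, r • e = 0 := by
    intro r hr
    ext s
    change c (Ideal.Quotient.mk _ (r * s)) = 0
    rw [Ideal.Quotient.eq_zero_iff_mem.2 (Ideal.mul_mem_right _ _ hr), map_zero]
  have hunit : ∀ (r : R), r ∉ maximalIdeal R → ∃ s, s * r = 1 := fun r hr =>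
    (IsLocalRing.notMem_maximalIdeal.1 hr).exists_left_inv
  obtain ⟨E, heE, hE⟩ := zorn_le_nonempty₀
    {E : Submodule R (CharacterModule R) | ∀ x ∈ E, x ≠ 0 → ∃ r : R, r • x = e}
    (by
      intro s hs hchain y hy
      refine ⟨sSup s, fun x hx => ?_, fun z hz => le_sSup hz⟩
      obtain ⟨F, hF, hxF⟩ := (Submodule.mem_sSup_of_directed ⟨y, hy⟩ hchain.directedOn).1 hx
      exact hs hF x hxF)
    (R ∙ e)
    (by
      intro x hx hx0
      obtain ⟨s, rfl⟩ := Submodule.mem_span_singleton.1 hx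
      obtain ⟨r, hr⟩ := hunit s fun h => hx0 (hme s h)
      exact ⟨r, by rw [smul_smul, hr, one_smul]⟩)
  have he' : e ∈ E := heE (Submodule.mem_span_singleton_self e)
  -- By maximality of `C`, the image of `E` in the quotient by `C` is essential. So an extension `h`
  -- of the inclusion of `E` to that quotient has image essential over `R ∙ e`, and maximality of
  -- `E` makes `h ∘ₗ C.mkQ` a retraction onto `E`.
  obtain ⟨C, -, hC⟩ := zorn_le_nonempty₀ {C : Submodule R (CharacterModule R) | Disjoint C E}
    (by
      intro s hs hchain y hy
      refine ⟨sSup s, ?_, fun z hz => le_sSup hz⟩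
      rw [Set.mem_ofPred_eq, Submodule.disjoint_def]
      intro x hx hxE
      obtain ⟨F, hF, hxF⟩ := (Submodule.mem_sSup_of_directed ⟨y, hy⟩ hchain.directedOn).1 hx
      exact Submodule.disjoint_def.1 (hs hF) x hxF hxE)
    ⊥ disjoint_bot_left
  have hCE := Submodule.disjoint_def.1 hC.prop
  obtain ⟨h, hh⟩ := (CharacterModule.baer R).exists_comp_eq (C.mkQ ∘ₗ E.subtype) E.subtype (by
    intro x hx
    have : (x : CharacterModule R) ∈ C := by simpa using hx
    exact hCE _ this x.2)
  have key : ∀ q, q ∉ C → ∃ r : R, r • h (C.mkQ q) ∈ E ∧ r • h (C.mkQ q) ≠ 0 := by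
    intro q hq
    have hlt : ¬ Disjoint (C ⊔ R ∙ q) E := fun hd =>
      hq (hC.le_of_ge hd le_sup_left (Submodule.mem_sup_right (Submodule.mem_span_singleton_self q)))
    rw [Submodule.disjoint_def] at hlt
    push Not at hlt
    obtain ⟨x, hx, hxE, hx0⟩ := hlt
    obtain ⟨y, hy, z, hz, rfl⟩ := Submodule.mem_sup.1 hx
    obtain ⟨r, rfl⟩ := Submodule.mem_span_singleton.1 hz
    have := hh ⟨_, hxE⟩
    have h3 : C.mkQ y = 0 := by simpa using hy
    simp only [LinearMap.comp_apply, Submodule.subtype_apply, map_add, map_smul, h3, zero_add] at this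
    exact ⟨r, by rw [this]; exact ⟨hxE, hx0⟩⟩
  have hrange : LinearMap.range (h ∘ₗ C.mkQ) ≤ E := by
    refine hE.le_of_ge ?_ ?_
    · rintro _ ⟨q, rfl⟩ h0
      obtain ⟨r, hr, hr0⟩ := key q (fun hq => h0 (by
        have h3 : C.mkQ q = 0 := by simpa using hq
        rw [LinearMap.comp_apply, h3, map_zero]))
      obtain ⟨s, hs⟩ := hE.prop _ hr hr0
      exact ⟨s * r, by rw [mul_smul]; exact hs⟩
    · intro x hx
      exact ⟨x, hh ⟨x, hx⟩⟩
  refine ⟨E, inferInstance, inferInstance, ⟨e, he'⟩, ?_, ?_, ?_, ?_⟩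
  · intro I g
    obtain ⟨g', hg'⟩ := CharacterModule.baer R I (E.subtype ∘ₗ g)
    refine ⟨(h ∘ₗ C.mkQ ∘ₗ g').codRestrict E (fun x => hrange ⟨g' x, rfl⟩), fun x hx => ?_⟩
    ext1
    simpa [hg' x hx] using hh (g ⟨x, hx⟩)
  · simpa using he0
  · intro r hr
    ext1
    exact hme r hr
  · intro x hx
    rw [Submodule.mem_span_singleton]
    by_cases hx0 : x = 0
    · exact ⟨0, by rw [hx0, zero_smul]⟩
    obtain ⟨r, hr⟩ := hE.prop x x.2 (by simpa using hx0)
    obtain ⟨s, hs⟩ := hunit r fun hrm => he0 (by rw [← hr]; exact congr_arg Subtype.val (hx r hrm))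
    refine ⟨s, ?_⟩
    ext1
    change s • e = x
    rw [← hr, smul_smul, hs, one_smul]

theorem isPrecomplete_pi {I : Ideal R} [IsPrecomplete I R] {ι : Type*} [Finite ι] :
    IsPrecomplete I (ι → R) := by
  classical
  cases nonempty_fintype ι
  refine ⟨fun f hf => ?_⟩
  have hproj : ∀ (n : ℕ) (i : ι) (x : ι → R), x ∈ (I ^ n • ⊤ : Submodule R (ι → R)) → x i ∈ I ^ n := by
    intro n i x hx
    refine Submodule.smul_induction_on (p := fun x : ι → R => x i ∈ I ^ n) hx ?_ ?_
    · intro r hr y _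
      exact Ideal.mul_mem_right _ _ hr
    · intro a b ha hb
      exact Ideal.add_mem _ ha hb
  have hL : ∀ i, ∃ L : R, ∀ n, f n i ≡ L [SMOD (I ^ n • ⊤ : Submodule R R)] := fun i =>
    IsPrecomplete.prec ‹_› (f := fun n => f n i) fun {m n} hmn => by
      rw [SModEq.sub_mem, smul_eq_mul, Ideal.mul_top]
      exact hproj m i _ (SModEq.sub_mem.1 (hf hmn))
  choose L hL using hL
  refine ⟨L, fun n => ?_⟩
  rw [SModEq.sub_mem, pi_eq_sum_univ' (f n - L)]
  refine Submodule.sum_mem _ fun i _ => Submodule.smul_mem_smul ?_ trivial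
  have := hL i n
  rwa [SModEq.sub_mem, smul_eq_mul, Ideal.mul_top] at this

/-- A separated module over an `I`-adically complete ring that is finite modulo `I` is finite. -/
theorem Module.Finite.of_isHausdorff_of_fg {I : Ideal R} [IsPrecomplete I R]
    (M : Type*) [AddCommGroup M] [Module R M] [IsHausdorff I M]
    [Module.Finite R (M ⧸ (I • ⊤ : Submodule R M))] : Module.Finite R M := by
  obtain ⟨n, g, hg⟩ := Module.Finite.exists_fin' R (M ⧸ (I • ⊤ : Submodule R M))
  obtain ⟨f, hf⟩ := Module.projective_lifting_property (I • ⊤ : Submodule R M).mkQ g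
    (Submodule.mkQ_surjective _)
  have : IsPrecomplete I (Fin n → R) := isPrecomplete_pi
  exact Module.Finite.of_surjective f (surjective_of_mkQ_comp_surjective (I := I) (hf ▸ hg))

end MatlisDuality

/-! ### Matlis duals of Artinian modules -/

section MatlisDual

universe u v w

variable {R : Type u} [CommRing R] [IsLocalRing R] {E : Type w} [AddCommGroup E] [Module R E] {e : E}
variable {N : Type v} [AddCommGroup N] [Module R N]

/-- Maps to a Matlis module separate points from submodules. -/
theorem IsMatlisModule.exists_apply_ne_zero (hE : IsMatlisModule R e) (C : Submodule R N) {x : N}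
    (hx : x ∉ C) : ∃ φ : N →ₗ[R] E, (∀ y ∈ C, φ y = 0) ∧ φ x ≠ 0 := by
  obtain ⟨k, hk⟩ := hE.baer.exists_comp_eq (LinearMap.toSpanSingleton R _ (C.mkQ x))
    (LinearMap.toSpanSingleton R _ e) (by
      intro r hr
      rw [LinearMap.mem_ker, LinearMap.toSpanSingleton_apply] at hr ⊢
      refine hE.smul_eq_zero r fun hu => hx ?_
      rw [← map_smul] at hr
      have h2 : r • x ∈ C := (Submodule.Quotient.mk_eq_zero C).1 hr
      exact (Submodule.smul_mem_iff_of_isUnit C hu).1 h2)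
  refine ⟨k ∘ₗ C.mkQ, fun y hy => ?_, ?_⟩
  · have : C.mkQ y = 0 := by simpa using hy
    rw [LinearMap.comp_apply, this, map_zero]
  · have := hk 1
    simp only [LinearMap.toSpanSingleton_apply, one_smul] at this
    rw [LinearMap.comp_apply, this]
    exact hE.ne_zero

/-- Every element of an Artinian module over a Noetherian local ring is killed by a power of the
maximal ideal. -/
theorem exists_maximalIdeal_pow_smul_eq_zero [IsNoetherianRing R] [IsArtinian R N] (x : N) :
    ∃ n : ℕ, ∀ r ∈ maximalIdeal R ^ n, r • x = 0 := by
  obtain ⟨n, hn⟩ := IsArtinian.monotone_stabilizes (R := R) (M := N)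
    ⟨fun n => OrderDual.toDual (maximalIdeal R ^ n • (R ∙ x)),
      fun a b hab => Submodule.smul_mono_left (Ideal.pow_le_pow_right hab)⟩
  have h1 : maximalIdeal R ^ n • (R ∙ x) = maximalIdeal R ^ (n + 1) • (R ∙ x) := hn (n + 1) n.le_succ
  have h2 : maximalIdeal R ^ n • (R ∙ x) = ⊥ := by
    -- Nakayama, at the place where the powers stabilize.
    refine Submodule.eq_bot_of_le_smul_of_le_jacobson_bot (maximalIdeal R) _ ?_ ?_
      (IsLocalRing.maximalIdeal_le_jacobson _)
    · exact (Submodule.fg_span_singleton x).smul (IsNoetherian.noetherian _)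
    · rw [smul_smul, ← pow_succ']
      exact h1.le
  refine ⟨n, fun r hr => ?_⟩
  have : r • x ∈ maximalIdeal R ^ n • (R ∙ x) :=
    Submodule.smul_mem_smul hr (Submodule.mem_span_singleton_self x)
  rwa [h2, Submodule.mem_bot] at this

/-- Each `x` is killed by some power of the maximal ideal, and multiples by that power in the dual
vanish at `x`. -/
theorem isHausdorff_linearMap [IsNoetherianRing R] [IsArtinian R N] :
    IsHausdorff (maximalIdeal R) (N →ₗ[R] E) := by
  refine ⟨fun φ hφ => ?_⟩
  ext x
  obtain ⟨n, hn⟩ := exists_maximalIdeal_pow_smul_eq_zero (R := R) x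
  have h := hφ n
  rw [SModEq.zero] at h
  refine Submodule.smul_induction_on (p := fun φ : N →ₗ[R] E => φ x = 0) h ?_ ?_
  · intro r hr ψ _
    rw [LinearMap.smul_apply, ← map_smul, hn r hr, map_zero]
  · intro a b ha hb
    rw [LinearMap.add_apply, ha, hb, add_zero]

/-- The socle of an Artinian module is finitely generated. -/
theorem fg_of_maximalIdeal_smul_eq_zero [IsArtinian R N] (S : Submodule R N)
    (hS : ∀ r ∈ maximalIdeal R, ∀ x ∈ S, r • x = 0) : S.FG := by
  have ht : Module.IsTorsionBySet R S (maximalIdeal R : Set R) := fun x r =>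
    Subtype.ext (hS r r.2 x x.2)
  let : Module (R ⧸ maximalIdeal R) S := ht.module
  have : IsScalarTower R (R ⧸ maximalIdeal R) S := ht.isScalarTower
  have : IsArtinian (R ⧸ maximalIdeal R) S := isArtinian_of_tower R inferInstance
  have : IsArtinianRing (R ⧸ maximalIdeal R) :=
    @DivisionRing.instIsArtinianRing _ (Ideal.Quotient.field (maximalIdeal R)).toDivisionRing
  have : Module.Finite (R ⧸ maximalIdeal R) S :=
    ((IsArtinianRing.tfae (R ⧸ maximalIdeal R) S).out 2 0).1 ‹_›
  exact Module.Finite.iff_fg.1 (Module.Finite.trans (R ⧸ maximalIdeal R) S)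

/-- The Matlis dual of an Artinian module over a complete Noetherian local ring is Noetherian. -/
theorem IsMatlisModule.isNoetherian_linearMap [IsNoetherianRing R]
    [IsAdicComplete (maximalIdeal R) R] [IsArtinian R N] (hE : IsMatlisModule R e) :
    IsNoetherian R (N →ₗ[R] E) := by
  classical
  obtain ⟨t, ht⟩ := (IsNoetherian.noetherian (maximalIdeal R) : (maximalIdeal R).FG)
  have htm : ∀ a ∈ t, a ∈ maximalIdeal R := fun a ha => ht ▸ Submodule.subset_span ha
  -- The socle of `N`. The dual is finite modulo the maximal ideal because restriction to the socle
  -- is finite data, and this lifts to the dual itself by completeness and separatedness.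
  let S : Submodule R N := ⨅ a : t, LinearMap.ker (LinearMap.lsmul R N (a : R))
  have hS : ∀ x ∈ S, ∀ r ∈ maximalIdeal R, r • x = 0 := by
    intro x hx r hr
    have : maximalIdeal R ≤ LinearMap.ker (LinearMap.toSpanSingleton R N x) := by
      rw [← ht, Submodule.span_le]
      intro a ha
      exact (Submodule.mem_iInf _).1 hx ⟨a, ha⟩
    exact this hr
  obtain ⟨s, hs⟩ := fg_of_maximalIdeal_smul_eq_zero S fun r hr x hx => hS x hx r hr
  let ev : (N →ₗ[R] E) →ₗ[R] (s → E) := LinearMap.pi fun x => LinearMap.applyₗ (x : N)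
  -- A functional killing the socle factors through `x ↦ (a • x)` for `a ∈ t`, whose kernel is the
  -- socle. Its components exhibit it as a combination with coefficients in `t`.
  have hev : LinearMap.ker ev ≤ maximalIdeal R • ⊤ := by
    intro φ hφ
    have hφS : S ≤ LinearMap.ker φ := by
      rw [← hs, Submodule.span_le]
      intro x hx
      exact congr($hφ ⟨x, hx⟩)
    obtain ⟨k, hk⟩ := hE.baer.exists_comp_eq
      (LinearMap.pi fun a : t => LinearMap.lsmul R N (a : R)) φ
      (by rw [LinearMap.ker_pi]; exact hφS)
    have : φ = ∑ a : t, (a : R) • (k ∘ₗ LinearMap.single R (fun _ => N) a) := by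
      ext x
      rw [← hk]
      conv_lhs => rw [← Finset.univ_sum_single ((LinearMap.pi fun a : t => LinearMap.lsmul R N (a : R)) x)]
      rw [map_sum, LinearMap.sum_apply]
      refine Finset.sum_congr rfl fun a _ => ?_
      rw [LinearMap.smul_apply, LinearMap.comp_apply, ← map_smul]
      congr 1
      rw [← map_smul]
      rfl
    rw [this]
    exact Submodule.sum_mem _ fun a _ => Submodule.smul_mem_smul (htm a a.2) trivial
  -- Functionals map the socle of `N` into the socle `R ∙ e` of `E`.
  have hfin : Module.Finite R (LinearMap.range ev) := by
    have hle : LinearMap.range ev ≤ Submodule.pi Set.univ fun _ : s => (R ∙ e) := by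
      rintro _ ⟨φ, rfl⟩ x -
      have hxS : (x : N) ∈ S := hs ▸ Submodule.subset_span x.2
      exact hE.mem_span _ fun r hr => by
        change r • φ x = 0
        rw [← map_smul, hS x hxS r hr, map_zero]
    have hnoeth : IsNoetherian R (Submodule.pi Set.univ fun _ : s => (R ∙ e)) := by
      let g : (s → (R ∙ e)) →ₗ[R] (s → E) := LinearMap.pi fun x => (R ∙ e).subtype ∘ₗ LinearMap.proj x
      have : (Submodule.pi Set.univ fun _ : s => (R ∙ e)) ≤ LinearMap.range g := by
        intro y hy
        exact ⟨fun x => ⟨y x, hy x trivial⟩, rfl⟩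
      exact isNoetherian_of_le this
    have : IsNoetherian R (LinearMap.range ev) := isNoetherian_of_le hle
    infer_instance
  have : Module.Finite R ((N →ₗ[R] E) ⧸ LinearMap.ker ev) :=
    Module.Finite.equiv ev.quotKerEquivRange.symm
  have : Module.Finite R ((N →ₗ[R] E) ⧸ (maximalIdeal R • ⊤ : Submodule R (N →ₗ[R] E))) :=
    Module.Finite.of_surjective (Submodule.factor hev) (Submodule.factor_surjective hev)
  have : IsHausdorff (maximalIdeal R) (N →ₗ[R] E) := isHausdorff_linearMap
  have : Module.Finite R (N →ₗ[R] E) := Module.Finite.of_isHausdorff_of_fg (I := maximalIdeal R) _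
  infer_instance

variable [IsNoetherianRing R] [IsAdicComplete (maximalIdeal R) R]

/-- Composition with finitely many generators of the dual of `N` embeds the maps into a finite power
of the dual of `X`, because functionals separate points of `N`. -/
theorem isNoetherian_linearMap_of_isArtinian {X : Type*} [AddCommGroup X] [Module R X]
    [IsArtinian R X] [IsArtinian R N] : IsNoetherian R (X →ₗ[R] N) := by
  obtain ⟨E, _, _, e, hE⟩ := exists_isMatlisModule R
  have := hE.isNoetherian_linearMap (N := N)
  have := hE.isNoetherian_linearMap (N := X)
  obtain ⟨t, ht⟩ := (IsNoetherian.noetherian (⊤ : Submodule R (N →ₗ[R] E)))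
  let g : (X →ₗ[R] N) →ₗ[R] (t → (X →ₗ[R] E)) :=
    LinearMap.pi fun φ => LinearMap.compRight R (φ : N →ₗ[R] E)
  refine isNoetherian_of_injective g (LinearMap.ker_eq_bot.1 (eq_bot_iff.2 fun f hf => ?_))
  rw [Submodule.mem_bot]
  by_contra hf0
  obtain ⟨x, hx⟩ : ∃ x, f x ≠ 0 := by
    by_contra! h
    exact hf0 (LinearMap.ext h)
  obtain ⟨φ, -, hφ⟩ := hE.exists_apply_ne_zero (⊥ : Submodule R N) hx
  have h1 : ⊤ ≤ LinearMap.ker (LinearMap.applyₗ (f x) : (N →ₗ[R] E) →ₗ[R] E) := by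
    rw [← ht, Submodule.span_le]
    intro ψ hψ
    exact congr($hf ⟨ψ, hψ⟩ x)
  exact hφ (h1 (x := φ) trivial)

/-- In an Artinian module over a complete Noetherian local ring, an ascending chain has a step
whose annihilator is not contained in a given prime annihilating the whole chain. -/
theorem exists_smul_le_of_isPrime [IsArtinian R N] {P : Ideal R} (hP : P.IsPrime)
    {C : ℕ → Submodule R N} (hC : Monotone C) (hPC : ∀ n, ∀ r ∈ P, ∀ x ∈ C n, r • x ∈ C 0) :
    ∃ n, ∃ r ∉ P, ∀ x ∈ C (n + 1), r • x ∈ C n := by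
  classical
  by_contra! hcon
  obtain ⟨E, _, _, e, hE⟩ := exists_isMatlisModule R
  have := hE.isNoetherian_linearMap (N := N)
  let M : ℕ → Submodule R (N →ₗ[R] E) := fun n =>
    { carrier := {φ | ∀ x ∈ C n, φ x = 0}
      zero_mem' := fun _ _ => rfl
      add_mem' := fun ha hb x hx => by rw [LinearMap.add_apply, ha x hx, hb x hx, add_zero]
      smul_mem' := fun r φ hφ x hx => by rw [LinearMap.smul_apply, hφ x hx, smul_zero] }
  have hM : Antitone M := fun a b hab φ hφ x hx => hφ x (hC hab hx)
  have hPM : ∀ n, ∀ r ∈ P, ∀ φ ∈ M 0, r • φ ∈ M n := by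
    intro n r hr φ hφ x hx
    rw [LinearMap.smul_apply, ← map_smul]
    exact hφ _ (hPC n r hr x hx)
  -- Otherwise each generator of `M n` is carried into `M (n + 1)` by an element outside `P`. The
  -- product of these elements carries all of `M n` there and, since functionals separate points
  -- from `C n`, multiplies `C (n + 1)` into `C n`.
  have hex : ∀ n, ∃ φ ∈ M n, ∀ r, r • φ ∈ M (n + 1) → r ∈ P := by
    intro n
    by_contra! h
    obtain ⟨t, ht⟩ := IsNoetherian.noetherian (M n)
    have htM : ∀ φ ∈ t, φ ∈ M n := fun φ hφ => ht ▸ Submodule.subset_span hφ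
    choose! r hr hrP using fun φ hφ => h φ (htM φ hφ)
    obtain ⟨x, hx, hxn⟩ := hcon n (∏ φ ∈ t, r φ) (by
      intro hmem
      obtain ⟨φ, hφ, hφP⟩ := (hP.prod_mem_iff).1 hmem
      exact hrP φ hφ hφP)
    obtain ⟨φ, hφC, hφx⟩ := hE.exists_apply_ne_zero (C n) hxn
    have hle : M n ≤ (M (n + 1)).comap (LinearMap.lsmul R _ (∏ φ ∈ t, r φ)) := by
      rw [← ht, Submodule.span_le]
      intro ψ hψ
      change (∏ φ ∈ t, r φ) • ψ ∈ M (n + 1)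
      rw [← Finset.prod_erase_mul _ _ hψ, mul_smul]
      exact Submodule.smul_mem _ _ (hr ψ hψ)
    refine hφx ?_
    rw [map_smul]
    exact hle (x := φ) hφC x hx
  choose φ hφ hφP using hex
  obtain ⟨n, hn⟩ := monotone_stabilizes_iff_noetherian.2 (inferInstance : IsNoetherian R (N →ₗ[R] E))
    ⟨fun n => Submodule.span R (φ '' Set.Iio n), fun a b hab =>
      Submodule.span_mono (Set.image_mono (Set.Iio_subset_Iio hab))⟩
  have hmem : φ n ∈ Submodule.span R (φ '' Set.Iio n) := by
    have := hn (n + 1) n.le_succ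
    change Submodule.span R (φ '' Set.Iio n) = Submodule.span R (φ '' Set.Iio (n + 1)) at this
    rw [this]
    exact Submodule.subset_span ⟨n, Nat.lt_succ_self n, rfl⟩
  -- The `φ i` are independent modulo `P`: terms of smaller index have coefficients in `P` and so
  -- lie in every `M k`, terms of larger index lie in `M (i + 1)`, hence so does `c i • φ i`.
  have hind : ∀ m, ∀ c : ℕ → R, ∑ i ∈ Finset.range m, c i • φ i = 0 → ∀ i < m, c i ∈ P := by
    intro m c hsum i
    induction i using Nat.strong_induction_on with
    | _ i ih =>
      intro him
      refine hφP i (c i) ?_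
      have hrest : ∑ j ∈ (Finset.range m).erase i, c j • φ j ∈ M (i + 1) := by
        refine Submodule.sum_mem _ fun j hj => ?_
        rw [Finset.mem_erase, Finset.mem_range] at hj
        rcases lt_or_gt_of_ne hj.1 with h | h
        · exact hPM _ _ (ih j h hj.2) _ (hM (Nat.zero_le j) (hφ j))
        · exact Submodule.smul_mem _ _ (hM h (hφ j))
      rw [← Finset.add_sum_erase _ _ (Finset.mem_range.2 him)] at hsum
      rw [eq_neg_of_add_eq_zero_left hsum]
      exact Submodule.neg_mem _ hrest
  obtain ⟨c, hc⟩ : ∃ c : ℕ → R, ∑ i ∈ Finset.range n, c i • φ i = φ n := by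
    have h2 : (Set.Iio n : Set ℕ) = (Finset.range n : Set ℕ) := by simp
    rw [h2] at hmem
    obtain ⟨c, hc⟩ := (Submodule.mem_span_image_finset_iff_exists_fun R).1 hmem
    refine ⟨fun i => if h : i ∈ Finset.range n then c ⟨i, h⟩ else 0, ?_⟩
    rw [← hc, ← Finset.sum_coe_sort]
    exact Finset.sum_congr rfl fun i _ => by
      simp only [dif_pos i.2]
  -- The relation expressing `φ n` through earlier terms has coefficient `-1` at `n`, which would
  -- have to lie in `P`.
  have := hind (n + 1) (Function.update c n (-1)) (by
    rw [Finset.sum_range_succ, Function.update_self, neg_smul, one_smul, ← hc, add_neg_eq_zero]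
    exact Finset.sum_congr rfl fun i hi => by
      rw [Function.update_of_ne (Finset.mem_range.1 hi).ne]) n (Nat.lt_succ_self n)
  rw [Function.update_self] at this
  exact hP.ne_top ((Ideal.eq_top_iff_one _).2 (by simpa using this))

end MatlisDual

/-- An associated prime of `R / I` is the annihilator of the class of some `s`. -/
theorem exists_isPrime_mem_iff_mul_mem {R : Type*} [CommRing R] [IsNoetherianRing R] {I : Ideal R}
    (hI : I ≠ ⊤) : ∃ P : Ideal R, P.IsPrime ∧ ∃ s, ∀ r, r ∈ P ↔ r * s ∈ I := by
  have : Nontrivial (R ⧸ I) := Ideal.Quotient.nontrivial_iff.2 hI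
  obtain ⟨P, hP⟩ := associatedPrimes.nonempty R (R ⧸ I)
  obtain ⟨hP, x, rfl⟩ := isAssociatedPrime_iff.1 hP
  obtain ⟨s, rfl⟩ := Ideal.Quotient.mk_surjective x
  refine ⟨_, hP, s, fun r => ?_⟩
  rw [Submodule.mem_colon_singleton, Submodule.mem_bot, ← Ideal.Quotient.eq_zero_iff_mem]
  rfl

theorem Submodule.pow_smul_mem {R N : Type*} [CommRing R] [AddCommGroup N] [Module R N]
    {B : Submodule R N} {n : ℕ} (hn : 1 ≤ n) {r : R} {x : N} (h : r • x ∈ B) : r ^ n • x ∈ B := by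
  rw [← Nat.sub_add_cancel hn, pow_succ, mul_smul]
  exact Submodule.smul_mem _ _ h

/-- Used with `n = p`: since `F (r • x) = r ^ p • F x` and `p ≥ 2`, control of `r • r • F x` gives
control of `F (r • x)`. -/
theorem Submodule.pow_smul_mem_of_two_le {R N : Type*} [CommRing R] [AddCommGroup N] [Module R N]
    {B : Submodule R N} {n : ℕ} (hn : 2 ≤ n) {r : R} {x : N} (h : r • r • x ∈ B) :
    r ^ n • x ∈ B := by
  rw [← Nat.sub_add_cancel hn, pow_add, sq, mul_smul, mul_smul]
  exact Submodule.smul_mem _ _ h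

/-! ### The Hartshorne–Speiser–Lyubeznik theorem -/

namespace FrobeniusAction

universe u v

variable {R : Type u} [CommRing R] {p : ℕ} [ExpChar R p]
variable {N : Type v} [AddCommGroup N] [Module R N]

theorem iterate_smul (F : N →ₛₗ[frobenius R p] N) (n : ℕ) (r : R) (x : N) :
    F^[n] (r • x) = r ^ p ^ n • F^[n] x := by
  induction n generalizing r x with
  | zero => simp
  | succ n ih =>
    rw [Function.iterate_succ_apply, Function.iterate_succ_apply, map_smulₛₗ, ih, frobenius_def,
      ← pow_mul, pow_succ']

theorem map_smul_eq_pow (F : N →ₛₗ[frobenius R p] N) (r : R) (x : N) :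
    F (r • x) = r ^ p • F x := map_smulₛₗ F r x

theorem mem_iterateKer (F : N →ₛₗ[frobenius R p] N) (n : ℕ) (x : N) :
    x ∈ iterateKer F n ↔ F^[n] x = 0 := Iff.rfl

theorem iterateKer_monotone (F : N →ₛₗ[frobenius R p] N) : Monotone (iterateKer F) := by
  refine monotone_nat_of_le_succ fun n x hx => ?_
  rw [mem_iterateKer] at hx ⊢
  rw [Function.iterate_succ_apply', hx, map_zero]

/-- The Hartshorne–Speiser–Lyubeznik theorem: on an Artinian module over a complete Noetherian
local ring, the kernels of the iterates of a `p`-linear map stabilize. -/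
theorem exists_iterateKer_le [IsNoetherianRing R] [IsLocalRing R]
    [IsAdicComplete (maximalIdeal R) R] [Fact p.Prime] [IsArtinian R N]
    (F : N →ₛₗ[frobenius R p] N) : ∃ e, ∀ n, iterateKer F n ≤ iterateKer F e := by
  set K := iterateKer F with hK
  have hKm : Monotone K := iterateKer_monotone F
  have hFK : ∀ n x, x ∈ K (n + 1) ↔ F x ∈ K n := fun n x => Iff.rfl
  have hFK' : ∀ n x, x ∈ K n → F x ∈ K n := fun n x hx => (hFK n x).1 (hKm n.le_succ hx)
  let I : ℕ → Ideal R := fun n =>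
    { carrier := {r | ∀ x ∈ K (n + 1), r • x ∈ K n}
      zero_mem' := fun x _ => by rw [zero_smul]; exact zero_mem _
      add_mem' := fun ha hb x hx => by rw [add_smul]; exact add_mem (ha x hx) (hb x hx)
      smul_mem' := fun c r hr x hx => by
        rw [smul_assoc]; exact Submodule.smul_mem _ _ (hr x hx) }
  have hIm : Monotone I := monotone_nat_of_le_succ fun n r hr x hx => by
    rw [hFK, map_smul_eq_pow]
    exact pow_smul_mem (Fact.out : p.Prime).one_le (hr _ ((hFK _ _).1 hx))
  obtain ⟨m, hm⟩ := monotone_stabilizes_iff_noetherian.2 (inferInstance : IsNoetherian R R) ⟨I, hIm⟩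
  have hm : ∀ n, m ≤ n → I m = I n := hm
  have h2 : ∀ n, ∀ r ∈ I m, ∀ x, F x ∈ K n → (∀ r' ∈ I m, ∀ y ∈ K n, r' • r' • y ∈ K m) →
      r • x ∈ K (m + 1) := by
    intro n r hr x hx h
    rw [hFK, map_smul_eq_pow]
    exact pow_smul_mem_of_two_le (Fact.out : p.Prime).two_le (h r hr _ hx)
  -- Applying the case `n` to `F y` puts `r • y` in `K (m + 1)`; the second factor `r ∈ I m` brings
  -- it down to `K m`.
  have h3 : ∀ n, ∀ r ∈ I m, ∀ y ∈ K n, r • r • y ∈ K m := by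
    intro n
    induction n with
    | zero =>
      intro r hr y hy
      exact Submodule.smul_mem _ _ (Submodule.smul_mem _ _ (hKm (Nat.zero_le m) hy))
    | succ n ih =>
      intro r hr y hy
      exact hr _ (h2 n r hr y ((hFK _ _).1 hy) ih)
  have h4 : ∀ n, ∀ r ∈ I m, ∀ x ∈ K n, r • x ∈ K (m + 1) := fun n r hr x hx =>
    h2 n r hr x (hFK' n x hx) (h3 n)
  by_cases hI : I m = ⊤
  · refine ⟨m, fun n => ?_⟩
    induction n with
    | zero => exact hKm (Nat.zero_le m)
    | succ n ih =>
      rcases le_total n m with h | h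
      · rcases h.eq_or_lt with rfl | h
        · intro x hx
          simpa using (hI ▸ trivial : (1 : R) ∈ I n) x hx
        · exact hKm h
      · intro x hx
        refine ih ?_
        simpa using ((hm n h) ▸ hI ▸ trivial : (1 : R) ∈ I n) x hx
  · exfalso
    obtain ⟨P, hP, s, hs⟩ := exists_isPrime_mem_iff_mul_mem hI
    -- With `P = (I m : s)`, multiplication by `s` maps every `K n` into `D` by `h4`. If `r ∉ P`
    -- multiplies one step of the chain within `D` into the previous term, then `r * s` lies in the
    -- stable ideal `I m`, which puts `r` in `P`.
    let D : Submodule R N :=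
      { carrier := {y | ∀ r ∈ P, r • y ∈ K (m + 1)}
        zero_mem' := fun r _ => by rw [smul_zero]; exact zero_mem _
        add_mem' := fun ha hb r hr => by rw [smul_add]; exact add_mem (ha r hr) (hb r hr)
        smul_mem' := fun c y hy r hr => by
          rw [smul_comm]; exact Submodule.smul_mem _ _ (hy r hr) }
    obtain ⟨n, r, hr, hn⟩ := exists_smul_le_of_isPrime hP (C := fun k => K (m + 1 + k) ⊓ D)
      (fun a b hab => inf_le_inf_right _ (hKm (Nat.add_le_add_left hab _)))
      (fun n r hr x hx => ⟨hx.2 r hr, Submodule.smul_mem _ _ hx.2⟩)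
    refine hr ((hs r).2 ?_)
    rw [hm (m + 1 + n) (by omega)]
    intro x hx
    rw [mul_smul]
    refine (hn (s • x) ⟨Submodule.smul_mem _ _ hx, fun t ht => ?_⟩).1
    rw [smul_smul]
    exact h4 _ _ ((hs t).1 ht) _ hx

end FrobeniusAction

/-- In an Artinian module, a sequence of submodules that is independent modulo `B` has a term
contained in `B`. -/
theorem IsArtinian.exists_le_of_inf_sup_le {R N : Type*} [Ring R] [AddCommGroup N] [Module R N]
    [IsArtinian R N] (B : Submodule R N) (L : ℕ → Submodule R N)
    (hL : ∀ n, L n ⊓ (B ⊔ ⨆ j ∈ Finset.range n, L j) ≤ B) : ∃ n, L n ≤ B := by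
  -- The tails `⨆ k, L (i + k)` descend and stabilize, so `L i` lies in the sum of later terms.
  -- Independence then lets those terms be removed one at a time, the last one first.
  have hanti : ∀ a b, a ≤ b → ⨆ k, L (b + k) ≤ ⨆ k, L (a + k) := fun a b hab =>
    iSup_le fun k => le_iSup_of_le (f := fun k => L (a + k)) (b - a + k) (by
      rw [← add_assoc, Nat.add_sub_cancel' hab])
  obtain ⟨i, hi⟩ := IsArtinian.monotone_stabilizes (R := R) (M := N)
    ⟨fun i => OrderDual.toDual (⨆ k, L (i + k)), fun a b hab => hanti a b hab⟩
  have hi : ⨆ k, L (i + k) = ⨆ k, L (i + 1 + k) := hi (i + 1) i.le_succ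
  refine ⟨i, fun x hx => ?_⟩
  have hx' : x ∈ ⨆ k, L (i + 1 + k) := hi ▸ (le_iSup (fun k => L (i + k)) 0 : L (i + 0) ≤ _) hx
  obtain ⟨n, hn⟩ : ∃ n, x ∈ B ⊔ ⨆ k ∈ Finset.range n, L (i + 1 + k) := by
    obtain ⟨s, hs⟩ := Submodule.mem_iSup_iff_exists_finset.1 hx'
    obtain ⟨n, hn⟩ := s.exists_nat_subset_range
    exact ⟨n, Submodule.mem_sup_right ((biSup_mono fun k hk => hn hk :
      ⨆ k ∈ s, L (i + 1 + k) ≤ ⨆ k ∈ Finset.range n, L (i + 1 + k)) hs)⟩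
  induction n with
  | zero => simpa using hn
  | succ n ih =>
    refine ih ?_
    rw [Finset.range_add_one, Finset.iSup_insert, sup_left_comm] at hn
    obtain ⟨y, hy, z, hz, rfl⟩ := Submodule.mem_sup.1 hn
    have hle : B ⊔ ⨆ k ∈ Finset.range n, L (i + 1 + k) ≤
        B ⊔ ⨆ j ∈ Finset.range (i + 1 + n), L j := by
      refine sup_le_sup_left (iSup₂_le fun k hk => ?_) _
      refine le_iSup₂_of_le (i + 1 + k) ?_ le_rfl
      rw [Finset.mem_range] at hk ⊢
      omega
    have hyB : y ∈ B := by
      refine hL (i + 1 + n) ⟨hy, ?_⟩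
      have h1 : y + z ∈ B ⊔ ⨆ j ∈ Finset.range (i + 1 + n), L j :=
        Submodule.mem_sup_right ((le_iSup₂_of_le (f := fun j (_ : j ∈ Finset.range (i + 1 + n)) => L j) i (Finset.mem_range.2 (by omega)) le_rfl :
          L i ≤ _) hx)
      have := Submodule.sub_mem _ h1 (hle hz)
      rwa [add_sub_cancel_right] at this
    exact Submodule.add_mem _ (Submodule.mem_sup_left hyB) hz

/-! ### Special submodules and the annihilators of stable submodules -/

namespace FrobeniusAction

universe u v

variable {R : Type u} [CommRing R] {p : ℕ} [ExpChar R p]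
variable {N : Type v} [AddCommGroup N] [Module R N] {F : N →ₛₗ[frobenius R p] N}

/-- An `F`-stable submodule such that `F` is injective on the quotient. -/
structure IsSpecial (F : N →ₛₗ[frobenius R p] N) (B : Submodule R N) : Prop where
  stable : IsFStable F B
  mem_of_map_mem : ∀ x, F x ∈ B → x ∈ B

theorem IsSpecial.mem_of_iterate_mem {B : Submodule R N} (hB : IsSpecial F B) (n : ℕ) {x : N}
    (hx : F^[n] x ∈ B) : x ∈ B := by
  induction n with
  | zero => exact hx
  | succ n ih =>
    rw [Function.iterate_succ_apply'] at hx
    exact ih (hB.mem_of_map_mem _ hx)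

theorem IsSpecial.inf {B C : Submodule R N} (hB : IsSpecial F B) (hC : IsSpecial F C) :
    IsSpecial F (B ⊓ C) :=
  ⟨hB.stable.inf hC.stable, fun x hx => ⟨hB.mem_of_map_mem x hx.1, hC.mem_of_map_mem x hx.2⟩⟩

theorem IsFStable.sup {B C : Submodule R N} (hB : IsFStable F B) (hC : IsFStable F C) :
    IsFStable F (B ⊔ C) := by
  intro x hx
  obtain ⟨y, hy, z, hz, rfl⟩ := Submodule.mem_sup.1 hx
  rw [map_add]
  exact Submodule.add_mem_sup (hB y hy) (hC z hz)

theorem IsFStable.bot : IsFStable F ⊥ := fun x hx => by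
  rw [Submodule.mem_bot] at hx ⊢
  rw [hx, map_zero]

theorem IsFStable.biSup_finset {ι : Type*} {L : ι → Submodule R N} (s : Finset ι)
    (hL : ∀ i ∈ s, IsFStable F (L i)) : IsFStable F (⨆ i ∈ s, L i) := by
  classical
  induction s using Finset.induction_on with
  | empty => simpa using IsFStable.bot
  | insert a s _ ih =>
    rw [Finset.iSup_insert]
    exact (hL a (Finset.mem_insert_self _ _)).sup
      (ih fun i hi => hL i (Finset.mem_insert_of_mem hi))

/-- The elements having an iterated image in an `F`-stable submodule. -/
def nilClosure (F : N →ₛₗ[frobenius R p] N) (B : Submodule R N) (hB : IsFStable F B) :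
    Submodule R N where
  carrier := {x | ∃ e : ℕ, F^[e] x ∈ B}
  zero_mem' := ⟨0, zero_mem _⟩
  add_mem' := by
    rintro a b ⟨m, hm⟩ ⟨n, hn⟩
    refine ⟨m + n, ?_⟩
    rw [iterate_map_add]
    refine add_mem ?_ ?_
    · rw [add_comm, Function.iterate_add_apply]
      exact hB.iterate_mem _ hm
    · rw [Function.iterate_add_apply]
      exact hB.iterate_mem _ hn
  smul_mem' := by
    rintro r x ⟨m, hm⟩
    exact ⟨m, by rw [iterate_smul]; exact Submodule.smul_mem _ _ hm⟩

theorem le_nilClosure {B : Submodule R N} (hB : IsFStable F B) : B ≤ nilClosure F B hB :=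
  fun _ hx => ⟨0, hx⟩

theorem isSpecial_nilClosure {B : Submodule R N} (hB : IsFStable F B) :
    IsSpecial F (nilClosure F B hB) where
  stable := fun x ⟨m, hm⟩ => ⟨m, by
    rw [← Function.iterate_succ_apply, Function.iterate_succ_apply']
    exact hB _ hm⟩
  mem_of_map_mem := fun x ⟨m, hm⟩ => ⟨m + 1, hm⟩

theorem nilClosure_le {B C : Submodule R N} (hB : IsFStable F B) (hC : IsSpecial F C)
    (h : B ≤ C) : nilClosure F B hB ≤ C :=
  fun _ ⟨m, hm⟩ => hC.mem_of_iterate_mem m (h hm)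

/-- The largest `F`-stable submodule that is multiplied into `B` by `I`. -/
def stableColon (F : N →ₛₗ[frobenius R p] N) (B : Submodule R N) (I : Ideal R) :
    Submodule R N where
  carrier := {x | ∀ n : ℕ, ∀ r ∈ I, r • F^[n] x ∈ B}
  zero_mem' := fun n r _ => by
    rw [Function.iterate_fixed (map_zero F), smul_zero]
    exact zero_mem _
  add_mem' := fun ha hb n r hr => by
    rw [iterate_map_add, smul_add]
    exact add_mem (ha n r hr) (hb n r hr)
  smul_mem' := fun c x hx n r hr => by
    rw [iterate_smul, smul_comm]
    exact Submodule.smul_mem _ _ (hx n r hr)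

theorem IsFStable.le_stableColon {B : Submodule R N} (hB : IsFStable F B) (I : Ideal R) :
    B ≤ stableColon F B I :=
  fun _ hx n _ _ => Submodule.smul_mem _ _ (hB.iterate_mem n hx)

section Prime

variable [Fact p.Prime]

variable (p) in
theorem one_le_pow (n : ℕ) : 1 ≤ p ^ n := Nat.one_le_pow _ _ (Fact.out : p.Prime).pos

theorem IsSpecial.smul_mem_of_map {B : Submodule R N} (hB : IsSpecial F B) {r : R} {x : N}
    (h : r • F x ∈ B) : r • x ∈ B :=
  hB.mem_of_map_mem _ (by
    rw [map_smul_eq_pow]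
    exact pow_smul_mem (Fact.out : p.Prime).one_le h)

theorem isSpecial_stableColon {B : Submodule R N} (hB : IsSpecial F B) (I : Ideal R) :
    IsSpecial F (stableColon F B I) where
  stable := fun x hx n => hx (n + 1)
  mem_of_map_mem := fun x hx n r hr => hB.smul_mem_of_map (by
    rw [← Function.iterate_succ_apply' F, Function.iterate_succ_apply]
    exact hx n r hr)

/-- Annihilators of stable submodules modulo a special one are radical, because `F (r • x) = r ^ p •
F x` with `F x ∈ L` and `p ≥ 2`. -/
theorem IsSpecial.smul_mem_of_smul_smul_mem {B L : Submodule R N} (hB : IsSpecial F B)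
    (hL : IsFStable F L) {r : R} (h : ∀ x ∈ L, r • r • x ∈ B) : ∀ x ∈ L, r • x ∈ B := by
  intro x hx
  refine hB.mem_of_map_mem _ ?_
  rw [map_smul_eq_pow]
  exact pow_smul_mem_of_two_le (Fact.out : p.Prime).two_le (h _ (hL x hx))

theorem IsFStable.map_lsmul {L : Submodule R N} (hL : IsFStable F L) (s : R) :
    IsFStable F (L.map (LinearMap.lsmul R N s)) := by
  rintro _ ⟨x, hx, rfl⟩
  rw [LinearMap.lsmul_apply, map_smul_eq_pow]
  exact pow_smul_mem (Fact.out : p.Prime).one_le ⟨F x, hL x hx, rfl⟩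

theorem IsFStable.ideal_smul {L : Submodule R N} (hL : IsFStable F L) (I : Ideal R) :
    IsFStable F (I • L) := by
  intro x hx
  refine Submodule.smul_induction_on (p := fun x => F x ∈ I • L) hx ?_ ?_
  · intro r hr y hy
    rw [map_smul_eq_pow]
    exact pow_smul_mem (Fact.out : p.Prime).one_le (Submodule.smul_mem_smul hr (hL y hy))
  · intro a b ha hb
    rw [map_add]
    exact add_mem ha hb

/-- When `L` is stable, the condition at exponent `0` implies those at all `n`, since `F^[n] (r •
x)` is a multiple of `r • F^[n] x`. Annihilators modulo `stableColon` can thus be computed modulo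
`B`. -/
theorem IsFStable.smul_mem_stableColon_iff {B L : Submodule R N} (hL : IsFStable F L) (I : Ideal R)
    (r : R) : (∀ x ∈ L, r • x ∈ stableColon F B I) ↔ ∀ s ∈ I, ∀ x ∈ L, s • r • x ∈ B := by
  constructor
  · intro h s hs x hx
    exact h x hx 0 s hs
  · intro h x hx n s hs
    rw [iterate_smul, smul_comm]
    refine pow_smul_mem (one_le_pow p n) ?_
    rw [smul_comm]
    exact h s hs _ (hL.iterate_mem n hx)

/-- The primes that are annihilators of `F`-stable submodules modulo `B`. -/
def stablePrimes (F : N →ₛₗ[frobenius R p] N) (B : Submodule R N) : Set (Ideal R) :=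
  {Q | Q.IsPrime ∧ ∃ L, IsFStable F L ∧ ∀ r, r ∈ Q ↔ ∀ x ∈ L, r • x ∈ B}

/-- An associated prime of the annihilator of `L` modulo `B` is the annihilator of some multiple `s
L`, which is again stable. -/
theorem exists_mem_stablePrimes [IsNoetherianRing R] {B L : Submodule R N} (hL : IsFStable F L)
    (h : ¬ L ≤ B) :
    ∃ Q ∈ stablePrimes F B, ∃ s, ∀ r, r ∈ Q ↔ ∀ x ∈ L, (r * s) • x ∈ B := by
  let I : Ideal R :=
    { carrier := {r | ∀ x ∈ L, r • x ∈ B}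
      zero_mem' := fun x _ => by rw [zero_smul]; exact zero_mem _
      add_mem' := fun ha hb x hx => by rw [add_smul]; exact add_mem (ha x hx) (hb x hx)
      smul_mem' := fun c r hr x hx => by
        rw [smul_assoc]; exact Submodule.smul_mem _ _ (hr x hx) }
  have hI : I ≠ ⊤ := fun hI => h fun x hx => by
    simpa using (hI ▸ trivial : (1 : R) ∈ I) x hx
  obtain ⟨P, hP, s, hs⟩ := exists_isPrime_mem_iff_mul_mem hI
  refine ⟨P, ⟨hP, L.map (LinearMap.lsmul R N s), hL.map_lsmul s, fun r => ?_⟩, s, hs⟩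
  rw [hs]
  constructor
  · rintro h _ ⟨x, hx, rfl⟩
    rw [LinearMap.lsmul_apply, smul_smul]
    exact h x hx
  · intro h x hx
    rw [mul_smul]
    exact h _ ⟨x, hx, rfl⟩

/-- Stable submodules with distinct maximal annihilators are independent modulo `B`: a prime
attached to `L n ⊓ (B ⊔ ⨆ j, L j)` would contain `Q n` and some `Q j`, hence equal both. An infinite
independent sequence contradicts the Artinian condition. -/
theorem finite_maximal_stablePrimes [IsNoetherianRing R] [IsArtinian R N] (B : Submodule R N)
    (hB : IsFStable F B) : {Q | Maximal (· ∈ stablePrimes F B) Q}.Finite := by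
  by_contra hinf
  have hinf : {Q | Maximal (· ∈ stablePrimes F B) Q}.Infinite := hinf
  let Q : ℕ → Ideal R := fun n => (hinf.natEmbedding _ n).1
  have hQ : ∀ n, Maximal (· ∈ stablePrimes F B) (Q n) := fun n => (hinf.natEmbedding _ n).2
  have hQinj : Function.Injective Q :=
    Subtype.val_injective.comp (hinf.natEmbedding _).injective
  choose L hL hLQ using fun n => (hQ n).prop.2
  obtain ⟨n, hn⟩ := IsArtinian.exists_le_of_inf_sup_le B L (by
    intro n
    by_contra hX
    obtain ⟨T, hT, s, hs⟩ := exists_mem_stablePrimes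
      ((hL n).inf (hB.sup (IsFStable.biSup_finset _ fun j _ => hL j))) hX
    have h1 : Q n ≤ T := fun r hr => (hs r).2 fun x hx => by
      rw [mul_comm, mul_smul]
      exact Submodule.smul_mem _ _ ((hLQ n r).1 hr x hx.1)
    have h2 : (Finset.range n).inf Q ≤ T := fun r hr => (hs r).2 fun x hx => by
      rw [mul_comm, mul_smul]
      refine Submodule.smul_mem _ _ ?_
      have hle : B ⊔ ⨆ j ∈ Finset.range n, L j ≤ B.comap (LinearMap.lsmul R N r) := by
        refine sup_le (fun y hy => Submodule.smul_mem _ _ hy) (iSup₂_le fun j hj y hy => ?_)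
        exact (hLQ j r).1 ((Finset.inf_le hj : (Finset.range n).inf Q ≤ Q j) hr) y hy
      exact hle hx.2
    obtain ⟨j, hj, hjT⟩ := (hT.1.inf_le').1 h2
    have h3 := (hQ n).eq_of_le hT h1
    have h4 := (hQ j).eq_of_le hT hjT
    exact (Finset.mem_range.1 hj).ne (hQinj (h4.trans h3.symm)))
  exact (hQ n).prop.1.ne_top ((Ideal.eq_top_iff_one _).2 ((hLQ n 1).2 fun x hx => by
    rw [one_smul]; exact hn hx))

/-- Let `I` be the intersection of the finitely many maximal members. Passing from `B` to
`stableColon F B I` removes exactly the maximal members: they disappear because annihilators are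
radical, and any other prime survives because it does not contain `I`. The heights drop, so
induction applies. -/
theorem finite_stablePrimes_of_height_lt [IsNoetherianRing R] [IsArtinian R N] (n : ℕ)
    {B : Submodule R N} (hB : IsSpecial F B) (h : ∀ Q ∈ stablePrimes F B, Q.height < n) :
    (stablePrimes F B).Finite := by
  induction n generalizing B with
  | zero => exact (Set.eq_empty_iff_forall_notMem.2 fun Q hQ => by simpa using h Q hQ) ▸ Set.finite_empty
  | succ n ih =>
    have hfin := finite_maximal_stablePrimes B hB.stable
    set I : Ideal R := hfin.toFinset.inf id with hI
    have hIQ : ∀ Q, Maximal (· ∈ stablePrimes F B) Q → I ≤ Q := fun Q hQ =>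
      (Finset.inf_le (hfin.mem_toFinset.2 hQ) : hfin.toFinset.inf id ≤ id Q)
    have hB' := isSpecial_stableColon hB I
    have hfin' : (stablePrimes F (stableColon F B I)).Finite := by
      refine ih hB' ?_
      rintro Q ⟨hQ, L, hL, hLQ⟩
      have hLQ' : ∀ r, r ∈ Q ↔ ∀ s ∈ I, ∀ x ∈ L, s • r • x ∈ B := fun r =>
        (hLQ r).trans (hL.smul_mem_stableColon_iff I r)
      have hmem : Q ∈ stablePrimes F B := by
        refine ⟨hQ, I • L, hL.ideal_smul I, fun r => (hLQ' r).trans ⟨fun h x hx => ?_, fun h s hs x hx => ?_⟩⟩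
        · refine Submodule.smul_induction_on (p := fun x => r • x ∈ B) hx ?_ ?_
          · intro s hs y hy
            rw [smul_comm]
            exact h s hs y hy
          · intro a b ha hb
            rw [smul_add]
            exact add_mem ha hb
        · rw [smul_comm]
          exact h _ (Submodule.smul_mem_smul hs hx)
      have hnot : ¬ Maximal (· ∈ stablePrimes F B) Q := by
        intro hmax
        refine hQ.ne_top ((Ideal.eq_top_iff_one _).2 ((hLQ' 1).2 fun s hs x hx => ?_))
        rw [one_smul]
        exact hB.smul_mem_of_smul_smul_mem hL ((hLQ' s).1 (hIQ Q hmax hs) s hs) x hx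
      obtain ⟨Q', hlt, hQ'⟩ := (not_maximal_iff_exists_gt hmem).1 hnot
      have := hQ'.1
      have h1 := Ideal.height_strict_mono_of_isPrime_of_isPrime hlt
      have h2 : Q'.height < n + 1 := by exact_mod_cast h Q' hQ'
      exact h1.trans_le (Order.le_of_lt_add_one h2)
    refine (hfin.union hfin').subset fun Q hQmem => ?_
    by_cases hmax : Maximal (· ∈ stablePrimes F B) Q
    · exact Or.inl hmax
    · right
      have hIQ' : ¬ I ≤ Q := by
        intro hle
        obtain ⟨Q', hQ', hle'⟩ := (hQmem.1.inf_le').1 hle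
        have hQ' := hfin.mem_toFinset.1 hQ'
        exact hmax (hQ'.eq_of_le hQmem hle' ▸ hQ')
      obtain ⟨hQ, L, hL, hLQ⟩ := hQmem
      obtain ⟨s, hs, hsQ⟩ := Set.not_subset.1 hIQ'
      refine ⟨hQ, L, hL, fun r => ?_⟩
      rw [hL.smul_mem_stableColon_iff]
      constructor
      · intro hr t ht x hx
        exact Submodule.smul_mem _ _ ((hLQ r).1 hr x hx)
      · intro h
        have : s * r ∈ Q := (hLQ _).2 fun x hx => by
          rw [mul_smul]
          exact h s hs x hx
        exact (hQ.mem_or_mem this).resolve_left hsQ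

/-- Heights are bounded by that of the maximal ideal, which is finite in a Noetherian ring. -/
theorem finite_stablePrimes [IsNoetherianRing R] [IsLocalRing R] [IsArtinian R N]
    {B : Submodule R N} (hB : IsSpecial F B) : (stablePrimes F B).Finite := by
  have h := Ideal.height_ne_top (I := maximalIdeal R) (Ideal.IsPrime.ne_top inferInstance)
  obtain ⟨n, hn⟩ := ENat.ne_top_iff_exists.1 h
  refine finite_stablePrimes_of_height_lt (n + 1) hB fun Q hQ => ?_
  have h1 : Q.height ≤ n := hn ▸ Ideal.height_mono (IsLocalRing.le_maximalIdeal hQ.1.ne_top)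
  exact h1.trans_lt (by exact_mod_cast Nat.lt_succ_self n)

/-- The `F`-stable submodules whose annihilator modulo `B` is not contained in `P` have a common
annihilator modulo `B` not contained in `P`. -/
theorem exists_ideal_smul_mem [IsNoetherianRing R] [IsLocalRing R] [IsArtinian R N]
    {B : Submodule R N} (hB : IsSpecial F B) {P : Ideal R} (hP : P.IsPrime) :
    ∃ J : Ideal R, ¬ J ≤ P ∧ ∀ L, IsFStable F L → (∃ r ∉ P, ∀ x ∈ L, r • x ∈ B) →
      ∀ r ∈ J, ∀ x ∈ L, r • x ∈ B := by
  -- The intersection of these finitely many primes serves as `J`.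
  have hfin : {Q | Q ∈ stablePrimes F B ∧ ¬ Q ≤ P}.Finite :=
    (finite_stablePrimes hB).subset fun Q hQ => hQ.1
  refine ⟨hfin.toFinset.inf id, fun hle => ?_, ?_⟩
  · obtain ⟨Q, hQ, hle'⟩ := (hP.inf_le').1 hle
    exact (hfin.mem_toFinset.1 hQ).2 hle'
  · rintro L hL ⟨t, htP, ht⟩ r hr
    by_contra! hcon
    obtain ⟨y, hy, hyB⟩ := hcon
    -- The prime `Q` contains `t ∉ P`, so `r ∈ J ≤ Q`. Then `s * r * r` multiplies `L` into `B`,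
    -- hence so does `(s * r) ^ 2`; by radicality so does `s * r`, that is, `1 ∈ Q`.
    obtain ⟨Q, hQ, s, hs⟩ := exists_mem_stablePrimes (B := B) (hL.map_lsmul r)
      fun hle => hyB (hle ⟨y, hy, rfl⟩)
    have htQ : t ∈ Q := by
      rw [hs]
      rintro _ ⟨x, hx, rfl⟩
      rw [LinearMap.lsmul_apply, mul_comm, mul_smul]
      refine Submodule.smul_mem _ _ ?_
      rw [smul_comm]
      exact Submodule.smul_mem _ _ (ht x hx)
    have hrQ : r ∈ Q := by
      have : hfin.toFinset.inf id ≤ id Q :=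
        Finset.inf_le (hfin.mem_toFinset.2 ⟨hQ, fun hle => htP (hle htQ)⟩)
      exact this hr
    refine hQ.1.ne_top ((Ideal.eq_top_iff_one _).2 ((hs 1).2 ?_))
    rintro _ ⟨x, hx, rfl⟩
    have := hB.smul_mem_of_smul_smul_mem hL (r := s * r) (fun z hz => by
      have h3 := Submodule.smul_mem _ s ((hs r).1 hrQ _ ⟨z, hz, rfl⟩)
      rw [LinearMap.lsmul_apply, smul_smul, smul_smul] at h3
      rw [smul_smul]
      convert h3 using 2
      ring) x hx
    rwa [LinearMap.lsmul_apply, one_mul, ← mul_smul]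

end Prime

end FrobeniusAction

/-! ### Ascending chain condition for special submodules -/

namespace FrobeniusAction

universe u v

variable {R : Type u} [CommRing R] {p : ℕ} [ExpChar R p]
variable {N : Type v} [AddCommGroup N] [Module R N] {F : N →ₛₗ[frobenius R p] N}

/-- A modular law up to nilpotents: if `F^[e] x = y + z` with `y ∈ L` and `z ∈ B`, then `z ∈ M ⊓ B ≤
L`. Stabilization of a chain can thus be tested on its intersections and sums with `B`. -/
theorem IsSpecial.le_of_inf_le_of_le_nilClosure {B L M : Submodule R N} (hL : IsSpecial F L)
    (hM : IsSpecial F M) (hLM : L ≤ M) (hB : IsFStable F B) (h1 : M ⊓ B ≤ L)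
    (h2 : M ≤ nilClosure F (L ⊔ B) (hL.stable.sup hB)) : M ≤ L := by
  intro x hx
  obtain ⟨e, he⟩ := h2 hx
  refine hL.mem_of_iterate_mem e ?_
  obtain ⟨y, hy, z, hz, hyz⟩ := Submodule.mem_sup.1 he
  have hzM : z ∈ M := by
    have := Submodule.sub_mem _ (hM.stable.iterate_mem e hx) (hLM hy)
    rwa [← hyz, add_sub_cancel_left] at this
  rw [← hyz]
  exact Submodule.add_mem _ hy (h1 ⟨hzM, hz⟩)

/-- Ascending chains of special submodules of an Artinian module over a complete Noetherian local
ring stabilize; here for chains that an ideal `I` multiplies into their first term. -/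
theorem exists_le_of_isSpecial_of_smul_mem [IsNoetherianRing R] [IsLocalRing R]
    [IsAdicComplete (maximalIdeal R) R] [Fact p.Prime] [IsArtinian R N] (I : Ideal R)
    {L : ℕ → Submodule R N} (hLm : Monotone L) (hL : ∀ n, IsSpecial F (L n))
    (hI : ∀ n, ∀ r ∈ I, ∀ x ∈ L n, r • x ∈ L 0) : ∃ n, ∀ m, L m ≤ L n := by
  induction I using WellFoundedGT.induction generalizing L with
  | _ I ih =>
    by_cases htop : I = ⊤
    · exact ⟨0, fun m x hx => by simpa using hI m 1 (htop ▸ trivial) x hx⟩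
    by_cases hP : I.IsPrime
    -- If all later terms are multiplied into `L i` by elements outside `I`, one ideal `J` not
    -- contained in `I` does so for all of them, and induction applies to `I ⊔ J` and the tail.
    -- Otherwise a subsequence has every step faithful over `R / I`, which the Matlis dual excludes.
    · by_cases h : ∃ i, ∀ j, i ≤ j → ∃ r ∉ I, ∀ x ∈ L j, r • x ∈ L i
      · obtain ⟨i, hi⟩ := h
        obtain ⟨J, hJ, hJL⟩ := exists_ideal_smul_mem (hL i) hP
        have hlt : I < I ⊔ J := lt_of_le_of_ne le_sup_left fun heq => hJ (heq ▸ le_sup_right)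
        obtain ⟨n, hn⟩ := ih (I ⊔ J) hlt (L := fun k => L (i + k))
          (fun a b hab => hLm (Nat.add_le_add_left hab i)) (fun n => hL _) (by
            intro n r hr x hx
            obtain ⟨a, ha, b, hb, rfl⟩ := Submodule.mem_sup.1 hr
            rw [add_smul]
            exact Submodule.add_mem _ (hLm (Nat.zero_le i) (hI _ a ha x hx))
              (hJL _ (hL (i + n)).stable (hi _ (Nat.le_add_right i n)) b hb x hx))
        exact ⟨i + n, fun m => (hLm (Nat.le_add_left m i)).trans (hn m)⟩
      · exfalso
        push Not at h
        choose g hg hgL using h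
        obtain ⟨n, r, hr, hn⟩ := exists_smul_le_of_isPrime hP (C := fun n => L (g^[n] 0))
          (monotone_nat_of_le_succ fun n => by
            rw [Function.iterate_succ_apply']
            exact hLm (hg _)) (fun n r hr x hx => hI _ r hr x hx)
        rw [Function.iterate_succ_apply'] at hn
        obtain ⟨x, hx, hxn⟩ := hgL (g^[n] 0) r hr
        exact hxn (hn x hx)
    · rw [Ideal.isPrime_iff] at hP
      push Not at hP
      obtain ⟨a, b, hab, ha, hb⟩ := hP htop
      have hlt : ∀ c, c ∉ I → I < I ⊔ Ideal.span {c} := fun c hc =>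
        lt_of_le_of_ne le_sup_left fun heq =>
          hc (heq ▸ Submodule.mem_sup_right (Ideal.mem_span_singleton_self c))
      have hmul : ∀ s ∈ I ⊔ Ideal.span {a}, ∀ t ∈ I ⊔ Ideal.span {b}, s * t ∈ I := by
        intro s hs t ht
        obtain ⟨i, hi, s', hs', rfl⟩ := Submodule.mem_sup.1 hs
        obtain ⟨j, hj, t', ht', rfl⟩ := Submodule.mem_sup.1 ht
        obtain ⟨c, rfl⟩ := Ideal.mem_span_singleton'.1 hs'
        obtain ⟨d, rfl⟩ := Ideal.mem_span_singleton'.1 ht'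
        have : (i + c * a) * (j + d * b) = (j + d * b) * i + (c * a) * j + (c * d) * (a * b) := by
          ring
        rw [this]
        exact add_mem (add_mem (I.mul_mem_left _ hi) (I.mul_mem_left _ hj)) (I.mul_mem_left _ hab)
      -- Since the product of `I + (a)` and `I + (b)` lies in `I`, the first ideal multiplies the
      -- intersections with `B` into the initial one, and the second does the same for the closures
      -- of the sums with `B`. Both chains stabilize by induction.
      set B := stableColon F (L 0) (I ⊔ Ideal.span {a}) with hBdef
      have hB : IsSpecial F B := isSpecial_stableColon (hL 0) _
      have hLB : L 0 ≤ B := (hL 0).stable.le_stableColon _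
      have hBs := fun n => (hL n).stable.sup hB.stable
      obtain ⟨n₁, h₁⟩ := ih _ (hlt a ha) (L := fun n => L n ⊓ B)
        (fun m n hmn => inf_le_inf_right _ (hLm hmn)) (fun n => (hL n).inf hB)
        (fun n r hr x hx => ⟨hx.2 0 r hr, Submodule.smul_mem _ _ hx.2⟩)
      obtain ⟨n₂, h₂⟩ := ih _ (hlt b hb) (L := fun n => nilClosure F (L n ⊔ B) (hBs n))
        (fun m n hmn => nilClosure_le _ (isSpecial_nilClosure _)
          ((sup_le_sup_right (hLm hmn) _).trans (le_nilClosure _)))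
        (fun n => isSpecial_nilClosure _) (by
          rintro n r hr x ⟨e, he⟩
          refine le_nilClosure _ (Submodule.mem_sup_right (hB.mem_of_iterate_mem e ?_))
          rw [iterate_smul]
          refine pow_smul_mem (one_le_pow p e) ?_
          obtain ⟨y, hy, z, hz, hyz⟩ := Submodule.mem_sup.1 he
          rw [← hyz, smul_add]
          refine Submodule.add_mem _ ?_ (Submodule.smul_mem _ _ hz)
          refine ((hL n).stable.smul_mem_stableColon_iff _ r).2 (fun s hs x hx => ?_) y hy
          rw [smul_smul]
          exact hI n _ (hmul s hs r hr) x hx)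
      refine ⟨max n₁ n₂, fun m => ?_⟩
      rcases le_total m (max n₁ n₂) with h | h
      · exact hLm h
      refine (hL _).le_of_inf_le_of_le_nilClosure (hL _) (hLm h) hB.stable ?_ ?_
      · exact (h₁ m).trans (inf_le_left.trans (hLm (le_max_left _ _)))
      · refine (le_sup_left.trans (le_nilClosure (hBs m))).trans ((h₂ m).trans ?_)
        exact nilClosure_le _ (isSpecial_nilClosure _)
          ((sup_le_sup_right (hLm (le_max_right _ _)) _).trans (le_nilClosure _))

/-- Special submodules of an Artinian module over a complete Noetherian local ring satisfy the
ascending chain condition. -/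
theorem wellFounded_gt_isSpecial [IsNoetherianRing R] [IsLocalRing R]
    [IsAdicComplete (maximalIdeal R) R] [Fact p.Prime] [IsArtinian R N]
    (F : N →ₛₗ[frobenius R p] N) : WellFoundedGT {L : Submodule R N // IsSpecial F L} := by
  rw [wellFoundedGT_iff_monotone_chain_condition']
  intro a
  obtain ⟨n, hn⟩ := exists_le_of_isSpecial_of_smul_mem (F := F) ⊥ (L := fun n => (a n).1)
    (fun m n hmn => a.monotone hmn) (fun n => (a n).2) (fun n r hr x _ => by
      rw [(Submodule.mem_bot R).1 hr, zero_smul]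
      exact zero_mem _)
  exact ⟨n, fun m _ hlt => hlt.not_ge (hn m)⟩

end FrobeniusAction

/-- In the fraction field, `a / b` is fixed by Frobenius, so it lies in the prime field. -/
theorem exists_natCast_mul_eq_of_pow_eq {D : Type*} [CommRing D] [IsDomain D] (p : ℕ)
    [Fact p.Prime] [CharP D p] {a b : D} (hb : b ≠ 0) (h : a ^ p = b ^ (p - 1) * a) :
    ∃ n < p, a = (n : D) * b := by
  let K := FractionRing D
  have : CharP K p := charP_of_injective_algebraMap (IsFractionRing.injective D K) p
  let := ZMod.algebra K p
  have hb' : algebraMap D K b ≠ 0 := fun h0 =>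
    hb (IsFractionRing.injective D K (by rw [h0, map_zero]))
  have hfix : (algebraMap D K a / algebraMap D K b) ^ p = algebraMap D K a / algebraMap D K b := by
    rw [div_pow, ← map_pow, h, map_mul, map_pow, div_eq_div_iff (pow_ne_zero _ hb') hb',
      ← Nat.sub_add_cancel (Fact.out : p.Prime).one_le, pow_succ, Nat.add_sub_cancel]
    ring
  rw [← Subfield.mem_bot_iff_pow_eq_self K p, Subfield.bot_eq_of_zMod_algebra p] at hfix
  obtain ⟨z, hz⟩ := hfix
  refine ⟨z.val, ZMod.val_lt z, IsFractionRing.injective D K ?_⟩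
  rw [map_mul, map_natCast]
  rw [eq_div_iff hb'] at hz
  rw [← hz, ← map_natCast (algebraMap (ZMod p) K), ZMod.natCast_zmod_val]

/-! ### Minimal stable submodules and their equivariant maps -/

namespace FrobeniusAction

universe u v

variable {R : Type u} [CommRing R] {p : ℕ} [ExpChar R p]
variable {N : Type v} [AddCommGroup N] [Module R N] {F : N →ₛₗ[frobenius R p] N}

/-- A minimal nonzero `F`-stable submodule. -/
structure IsMinimalStable (F : N →ₛₗ[frobenius R p] N) (X : Submodule R N) : Prop where
  stable : IsFStable F X
  ne_bot : X ≠ ⊥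
  eq_of_le : ∀ Y, IsFStable F Y → Y ≤ X → Y ≠ ⊥ → Y = X

theorem IsMinimalStable.inf_eq_bot {X Y : Submodule R N} (hX : IsMinimalStable F X)
    (hY : IsFStable F Y) (h : ¬ X ≤ Y) : X ⊓ Y = ⊥ := by
  by_contra hne
  exact h (inf_eq_left.1 (hX.eq_of_le _ (hX.stable.inf hY) inf_le_left hne))

/-- The `R`-linear maps from an `F`-stable submodule to `N` commuting with `F`. -/
def equivariantHom (F : N →ₛₗ[frobenius R p] N) (X : Submodule R N) (hX : IsFStable F X) :
    AddSubgroup (X →ₗ[R] N) where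
  carrier := {f | ∀ x, f (restrictMap F X hX x) = F (f x)}
  zero_mem' := fun x => by simp
  add_mem' := fun ha hb x => by simp only [LinearMap.add_apply, map_add]; rw [ha x, hb x]
  neg_mem' := fun ha x => by simp only [LinearMap.neg_apply, map_neg]; rw [ha x]

theorem IsFStable.map_of_mem_equivariantHom {X : Submodule R N} {hX : IsFStable F X}
    {f : X →ₗ[R] N} (hf : f ∈ equivariantHom F X hX) : IsFStable F (LinearMap.range f) := by
  rintro _ ⟨x, rfl⟩
  exact ⟨_, hf x⟩

/-- Otherwise minimal submodules can be chosen successively outside the sum of the previous ones. By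
minimality each meets that sum in zero, so they are independent, contrary to the Artinian condition.
-/
theorem exists_finset_iSup_of_isMinimalStable [IsArtinian R N] (F : N →ₛₗ[frobenius R p] N) :
    ∃ t : Finset {X : Submodule R N // IsMinimalStable F X},
      ∀ X, IsMinimalStable F X → X ≤ ⨆ Y ∈ t, Y.1 := by
  classical
  by_contra! hcon
  choose g hg hgt using hcon
  let s : ℕ → Finset {X : Submodule R N // IsMinimalStable F X} := fun n =>
    Nat.rec ∅ (fun _ t => insert ⟨g t, hg t⟩ t) n
  have hs : Monotone s := monotone_nat_of_le_succ fun n => Finset.subset_insert _ _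
  obtain ⟨n, hn⟩ := IsArtinian.exists_le_of_inf_sup_le (⊥ : Submodule R N) (fun n => g (s n)) (by
    intro n
    rw [bot_sup_eq, (hg (s n)).inf_eq_bot (IsFStable.biSup_finset _ fun j _ => (hg (s j)).stable)]
    intro hle
    refine hgt (s n) (hle.trans (iSup₂_le fun j hj => ?_))
    have : (⟨g (s j), hg (s j)⟩ : {X : Submodule R N // IsMinimalStable F X}) ∈ s n :=
      hs (Finset.mem_range.1 hj : j + 1 ≤ n) (Finset.mem_insert_self _ _)
    exact le_iSup₂_of_le (f := fun (Y : {X : Submodule R N // IsMinimalStable F X})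
      (_ : Y ∈ s n) => Y.1) _ this le_rfl)
  exact (hg (s n)).ne_bot (le_bot_iff.1 hn)

/-- Both `X` and `Y` are complements of `C` in the same submodule, so projection along `C` carries
`Y` onto `X` and commutes with `F`. -/
theorem IsMinimalStable.exists_range_eq {X Y C : Submodule R N} (hX : IsMinimalStable F X)
    (hY : IsMinimalStable F Y) (hC : IsFStable F C) (hXC : ¬ X ≤ C) (hYC : ¬ Y ≤ C)
    (hXYC : X ≤ Y ⊔ C) : ∃ f ∈ equivariantHom F Y hY.stable, LinearMap.range f = X := by
  have hX0 := (Submodule.eq_bot_iff _).1 (hX.inf_eq_bot hC hXC)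
  have hY0 := (Submodule.eq_bot_iff _).1 (hY.inf_eq_bot hC hYC)
  have hYX : Y ≤ X ⊔ C := by
    by_contra hle
    refine hX.ne_bot ((Submodule.eq_bot_iff _).2 fun x hx => ?_)
    obtain ⟨y, hy, c, hc, rfl⟩ := Submodule.mem_sup.1 (hXYC hx)
    have : y ∈ Y ⊓ (X ⊔ C) := ⟨hy, by
      have := Submodule.sub_mem _ (Submodule.mem_sup_left hx) (Submodule.mem_sup_right hc : c ∈ X ⊔ C)
      rwa [add_sub_cancel_right] at this⟩
    rw [hY.inf_eq_bot (hX.stable.sup hC) hle, Submodule.mem_bot] at this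
    rw [this, zero_add] at hx ⊢
    exact hX0 c ⟨hx, hc⟩
  have hex : ∀ y : Y, ∃ x ∈ X, x - y ∈ C := by
    intro y
    obtain ⟨x, hx, c, hc, h⟩ := Submodule.mem_sup.1 (hYX y.2)
    exact ⟨x, hx, by rw [← h, sub_add_cancel_left]; exact neg_mem hc⟩
  choose f hfX hfC using hex
  have huniq : ∀ a ∈ X, ∀ b ∈ X, ∀ y : N, a - y ∈ C → b - y ∈ C → a = b := by
    intro a ha b hb y h1 h2
    refine sub_eq_zero.1 (hX0 _ ⟨sub_mem ha hb, ?_⟩)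
    rw [← sub_sub_sub_cancel_right a b y]
    exact sub_mem h1 h2
  let f' : Y →ₗ[R] N :=
    { toFun := f
      map_add' := fun a b => huniq _ (hfX _) _ (add_mem (hfX a) (hfX b)) _ (hfC _) (by
        rw [Submodule.coe_add, add_sub_add_comm]
        exact add_mem (hfC a) (hfC b))
      map_smul' := fun r a => huniq _ (hfX _) _ (X.smul_mem r (hfX a)) _ (hfC _) (by
        rw [Submodule.coe_smul, RingHom.id_apply, ← smul_sub]
        exact C.smul_mem r (hfC a)) }
  have hf' : f' ∈ equivariantHom F Y hY.stable := fun y =>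
    huniq _ (hfX _) _ (hX.stable _ (hfX y)) _ (hfC _) (by
      change F (f y) - F (y : N) ∈ C
      rw [← map_sub]
      exact hC _ (hfC y))
  refine ⟨f', hf', hX.eq_of_le _ (IsFStable.map_of_mem_equivariantHom hf') ?_ fun h0 => ?_⟩
  · rintro _ ⟨y, rfl⟩
    exact hfX y
  · refine hY.ne_bot ((Submodule.eq_bot_iff _).2 fun y hy => hY0 y ⟨hy, ?_⟩)
    have h1 : f' ⟨y, hy⟩ = 0 := by
      have : f' ⟨y, hy⟩ ∈ LinearMap.range f' := ⟨_, rfl⟩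
      rwa [h0, Submodule.mem_bot] at this
    have h2 : f' ⟨y, hy⟩ - y ∈ C := hfC ⟨y, hy⟩
    rw [h1, zero_sub] at h2
    exact neg_mem_iff.1 h2

theorem IsMinimalStable.exists_mem_range_eq {X : Submodule R N} (hX : IsMinimalStable F X)
    (t : Finset {X : Submodule R N // IsMinimalStable F X}) (h : X ≤ ⨆ Y ∈ t, Y.1) :
    ∃ Y ∈ t, ∃ f ∈ equivariantHom F Y.1 Y.2.stable, LinearMap.range f = X := by
  classical
  induction t using Finset.induction_on with
  | empty => exact absurd (by simpa using h) hX.ne_bot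
  | insert Y t _ ih =>
    have hC : IsFStable F (⨆ Z ∈ t, Z.1) := IsFStable.biSup_finset t fun Z _ => Z.2.stable
    have lift : X ≤ ⨆ Z ∈ t, Z.1 → ∃ Z ∈ insert Y t, ∃ f ∈ equivariantHom F Z.1 Z.2.stable,
        LinearMap.range f = X := fun hle => by
      obtain ⟨Z, hZ, hf⟩ := ih hle
      exact ⟨Z, Finset.mem_insert_of_mem hZ, hf⟩
    rw [Finset.iSup_insert] at h
    by_cases h1 : X ≤ ⨆ Z ∈ t, Z.1
    · exact lift h1
    by_cases h2 : Y.1 ≤ ⨆ Z ∈ t, Z.1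
    · exact lift (h.trans (sup_le h2 le_rfl))
    exact ⟨Y, Finset.mem_insert_self _ _, hX.exists_range_eq Y.2 hC h1 h2 h⟩

variable {X : Submodule R N}

/-- A multiple `a X` is stable, hence `0` or `X`. -/
theorem IsMinimalStable.isPrime_annihilator [Fact p.Prime] (hX : IsMinimalStable F X) :
    X.annihilator.IsPrime := by
  rw [Ideal.isPrime_iff]
  refine ⟨fun h => hX.ne_bot (Submodule.annihilator_eq_top_iff.1 h), fun {a b} hab => ?_⟩
  by_contra! h
  have hne : X.map (LinearMap.lsmul R N a) ≠ ⊥ := fun h0 => h.1 (Submodule.mem_annihilator.2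
    fun x hx => (Submodule.eq_bot_iff _).1 h0 _ ⟨x, hx, rfl⟩)
  have heq := hX.eq_of_le _ (hX.stable.map_lsmul a)
    (by rintro _ ⟨x, hx, rfl⟩; exact X.smul_mem a hx) hne
  refine h.2 (Submodule.mem_annihilator.2 fun x hx => ?_)
  rw [← heq] at hx
  obtain ⟨y, hy, rfl⟩ := hx
  rw [LinearMap.lsmul_apply, smul_smul, mul_comm]
  exact Submodule.mem_annihilator.1 hab y hy

theorem smul_eq_zero_of_mem_annihilator {r : R} (hr : r ∈ X.annihilator) (f : X →ₗ[R] N) :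
    r • f = 0 := by
  ext x
  have : r • x = 0 := Subtype.ext (Submodule.mem_annihilator.1 hr x x.2)
  rw [LinearMap.smul_apply, ← map_smul, this, map_zero, LinearMap.zero_apply]

/-- A nonzero equivariant map has a proper stable kernel, hence is injective. So equivariant maps
are torsion-free over the quotient by the annihilator of `X`. -/
theorem IsMinimalStable.eq_zero_of_smul_eq_zero (hX : IsMinimalStable F X) {f : X →ₗ[R] N}
    (hf : f ∈ equivariantHom F X hX.stable) {r : R} (hr : r ∉ X.annihilator) (h : r • f = 0) :
    f = 0 := by
  by_contra hf0
  have hst : IsFStable F ((LinearMap.ker f).map X.subtype) := by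
    rintro _ ⟨x, hx, rfl⟩
    refine ⟨restrictMap F X hX.stable x, ?_, rfl⟩
    rw [SetLike.mem_coe, LinearMap.mem_ker] at hx ⊢
    rw [hf x, hx, map_zero]
  have hker : (LinearMap.ker f).map X.subtype = ⊥ := by
    by_contra hne
    have heq := hX.eq_of_le _ hst (by rintro _ ⟨x, _, rfl⟩; exact x.2) hne
    refine hf0 (LinearMap.ext fun x => ?_)
    have hx : (x : N) ∈ (LinearMap.ker f).map X.subtype := heq.symm ▸ x.2
    obtain ⟨y, hy, hyx⟩ := hx
    rw [← Subtype.ext hyx]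
    exact hy
  refine hr (Submodule.mem_annihilator.2 fun x hx => ?_)
  refine (Submodule.eq_bot_iff _).1 hker _ ⟨r • ⟨x, hx⟩, ?_, rfl⟩
  rw [SetLike.mem_coe, LinearMap.mem_ker, map_smul]
  exact congr($h ⟨x, hx⟩)

/-- As `F` is injective, the span of `F(X)` is a nonzero stable submodule of `X`, hence all of `X`.
-/
theorem IsMinimalStable.eq_zero_of_comp_eq_zero (hX : IsMinimalStable F X)
    (hF : Function.Injective F) {f : X →ₗ[R] N} (h : ∀ x, f (restrictMap F X hX.stable x) = 0) : f = 0 := by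
  have hZX : span R (F '' X) ≤ X := span_le.2 (by rintro _ ⟨x, hx, rfl⟩; exact hX.stable x hx)
  have hst : IsFStable F (span R (F '' X)) := fun x hx => subset_span ⟨x, hZX hx, rfl⟩
  have heq := hX.eq_of_le _ hst hZX fun h0 => hX.ne_bot ((Submodule.eq_bot_iff _).2 fun x hx =>
    hF (by rw [map_zero]; exact (Submodule.eq_bot_iff _).1 h0 _ (subset_span ⟨x, hx, rfl⟩)))
  have hle : span R (F '' X) ≤ (LinearMap.ker f).map X.subtype := span_le.2 (by
    rintro _ ⟨x, hx, rfl⟩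
    exact ⟨restrictMap F X hX.stable ⟨x, hx⟩, h ⟨x, hx⟩, rfl⟩)
  ext x
  obtain ⟨y, hy, hyx⟩ := hle (heq.symm ▸ x.2 : (x : N) ∈ _)
  rw [← Subtype.ext hyx]
  exact hy

/-- Choose finitely many equivariant maps, independent modulo `P`, with maximal span. Any further
one is shown to be a combination of them with coefficients in the prime field, which leaves finitely
many choices. -/
theorem IsMinimalStable.finite_equivariantHom [IsNoetherianRing R] [IsLocalRing R]
    [IsAdicComplete (maximalIdeal R) R] [Fact p.Prime] [IsArtinian R N]
    (hX : IsMinimalStable F X) (hF : Function.Injective F) :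
    (equivariantHom F X hX.stable : Set (X →ₗ[R] N)).Finite := by
  classical
  set V := equivariantHom F X hX.stable with hV
  set P := X.annihilator with hPdef
  have hP : P.IsPrime := hX.isPrime_annihilator
  have hnoeth : IsNoetherian R (X →ₗ[R] N) := isNoetherian_linearMap_of_isArtinian
  let Indep : Finset (X →ₗ[R] N) → Prop := fun t =>
    ∀ c : (X →ₗ[R] N) → R, ∑ g ∈ t, c g • g = 0 → ∀ g ∈ t, c g ∈ P
  obtain ⟨_, ⟨t, htV, ht, rfl⟩, hmax⟩ := set_has_maximal_iff_noetherian.2 hnoeth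
    {W | ∃ t : Finset (X →ₗ[R] N), (t : Set (X →ₗ[R] N)) ⊆ V ∧ Indep t ∧ span R (t : Set _) = W}
    ⟨_, ∅, by simp, fun c _ g hg => absurd hg (Finset.notMem_empty g), rfl⟩
  refine (Set.finite_range fun n : t → Fin p => -∑ g : t, (n g : ℕ) • (g : X →ₗ[R] N)).subset ?_
  intro f hf
  -- Inside the span `r = 1` works. Outside it, adjoining `f` enlarges the span, so independence
  -- fails, and the coefficient of `f` cannot lie in `P` by independence of `t`.
  obtain ⟨c, r, hr, hsum⟩ : ∃ c : (X →ₗ[R] N) → R, ∃ r : R, r ∉ P ∧ r • f + ∑ g ∈ t, c g • g = 0 := by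
    by_cases hft : f ∈ span R (t : Set (X →ₗ[R] N))
    · obtain ⟨c, -, hc⟩ := Submodule.mem_span_finset.1 hft
      refine ⟨fun g => -c g, 1, fun h1 => hP.ne_top ((Ideal.eq_top_iff_one _).2 h1), ?_⟩
      simp only [neg_smul, Finset.sum_neg_distrib, hc, one_smul, add_neg_cancel]
    · have hft' : f ∉ t := fun h => hft (subset_span h)
      have hnot : ¬ Indep (insert f t) := fun hind => by
        refine hmax _ ⟨insert f t, ?_, hind, rfl⟩ (lt_of_le_of_ne (span_mono ?_) fun heq => hft ?_)
        · rw [Finset.coe_insert]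
          exact Set.insert_subset hf htV
        · rw [Finset.coe_insert]
          exact Set.subset_insert _ _
        · rw [heq]
          exact subset_span (Finset.mem_insert_self f t)
      simp only [Indep] at hnot
      push Not at hnot
      obtain ⟨c, hc, g, hg, hgP⟩ := hnot
      rw [Finset.sum_insert hft'] at hc
      refine ⟨c, c f, fun hcf => ?_, hc⟩
      rw [smul_eq_zero_of_mem_annihilator hcf, zero_add] at hc
      rcases Finset.mem_insert.1 hg with rfl | hg
      · exact hgP hcf
      · exact hgP (ht c hc g hg)
  -- Subtract `F` of the relation at `x` from `r ^ (p - 1)` times the relation at `F x`: the terms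
  -- in `f` cancel. Independence then gives `c g ^ p ≡ r ^ (p - 1) * c g` modulo `P`.
  have hrel : ∑ g ∈ t, (r ^ (p - 1) * c g - c g ^ p) • g = 0 := by
    refine hX.eq_zero_of_comp_eq_zero hF fun x => ?_
    have h1 := congr($hsum (restrictMap F X hX.stable x))
    have h2 := congr(F ($hsum x))
    simp only [LinearMap.add_apply, LinearMap.smul_apply, LinearMap.sum_apply, map_add, map_sum,
      map_smul_eq_pow, LinearMap.zero_apply, map_zero] at h1 h2 ⊢
    rw [hf x, Finset.sum_congr rfl fun g hg => by rw [htV hg x]] at h1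
    rw [Finset.sum_congr rfl fun g hg => by rw [htV hg x, sub_smul, mul_smul],
      Finset.sum_sub_distrib, ← Finset.smul_sum, eq_neg_of_add_eq_zero_right h1,
      eq_neg_of_add_eq_zero_right h2, smul_neg, smul_smul, ← pow_succ,
      Nat.sub_add_cancel (Fact.out : p.Prime).one_le, sub_self]
  have hex : ∀ g : t, ∃ n : Fin p, c g - (n : ℕ) * r ∈ P := by
    intro g
    have hpP : CharP (R ⧸ P) p := by
      have : CharP R p := by
        cases ‹ExpChar R p› with
        | zero => exact absurd (Fact.out : Nat.Prime 1) Nat.not_prime_one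
        | prime _ => assumption
      have : Nontrivial (R ⧸ P) := Ideal.Quotient.nontrivial_iff.2 hP.ne_top
      refine ringChar.of_eq (CharP.ringChar_of_prime_eq_zero Fact.out ?_)
      rw [← map_natCast (Ideal.Quotient.mk P), CharP.cast_eq_zero, map_zero]
    obtain ⟨n, hn, h⟩ := exists_natCast_mul_eq_of_pow_eq p (a := Ideal.Quotient.mk P (c g))
      (b := Ideal.Quotient.mk P r) (fun h => hr (Ideal.Quotient.eq_zero_iff_mem.1 h)) (by
        rw [← map_pow, ← map_pow, ← map_mul, eq_comm, Ideal.Quotient.eq]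
        exact ht _ hrel g g.2)
    refine ⟨⟨n, hn⟩, ?_⟩
    rw [← Ideal.Quotient.eq, h, map_mul, map_natCast]
  choose n hn using hex
  refine ⟨n, ?_⟩
  have hmem : f + ∑ g : t, (n g : ℕ) • (g : X →ₗ[R] N) ∈ V :=
    add_mem hf (sum_mem fun g _ => nsmul_mem (htV g.2) _)
  have hzero : r • (f + ∑ g : t, (n g : ℕ) • (g : X →ₗ[R] N)) = 0 := by
    rw [smul_add, ← hsum, Finset.smul_sum, ← Finset.sum_coe_sort t]
    congr 1
    refine Finset.sum_congr rfl fun g _ => ?_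
    have := smul_eq_zero_of_mem_annihilator (hn g) (g : X →ₗ[R] N)
    rw [sub_smul, sub_eq_zero] at this
    rw [this, mul_comm, mul_smul, Nat.cast_smul_eq_nsmul]
  exact (eq_neg_of_add_eq_zero_left (hX.eq_zero_of_smul_eq_zero hmem hr hzero)).symm

end FrobeniusAction

/-! ### Finiteness of special submodules and the conclusions -/

namespace FrobeniusAction

universe u v

variable {R : Type u} [CommRing R] {p : ℕ} [ExpChar R p]
variable {N : Type v} [AddCommGroup N] [Module R N] {F : N →ₛₗ[frobenius R p] N}
theorem IsSpecial.injective_quotientMap {L : Submodule R N} (hL : IsSpecial F L) :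
    Function.Injective (quotientMap F L hL.stable) := by
  rw [injective_iff_map_eq_zero]
  intro x hx
  obtain ⟨x, rfl⟩ := Submodule.Quotient.mk_surjective _ x
  exact (Submodule.Quotient.mk_eq_zero _).2
    (hL.mem_of_map_mem x ((Submodule.Quotient.mk_eq_zero _).1 hx))

theorem isSpecial_of_injective_quotientMap {L : Submodule R N} (hL : IsFStable F L)
    (h : Function.Injective (quotientMap F L hL)) : IsSpecial F L where
  stable := hL
  mem_of_map_mem x hx := by
    rw [injective_iff_map_eq_zero] at h
    exact (Submodule.Quotient.mk_eq_zero _).1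
      (h (Submodule.Quotient.mk x) ((Submodule.Quotient.mk_eq_zero _).2 hx))

variable [IsNoetherianRing R] [IsLocalRing R] [IsAdicComplete (maximalIdeal R) R] [Fact p.Prime]
  [IsArtinian R N]

theorem finite_isMinimalStable (hF : Function.Injective F) :
    {X : Submodule R N | IsMinimalStable F X}.Finite := by
  obtain ⟨t, ht⟩ := exists_finset_iSup_of_isMinimalStable F
  refine (t.finite_toSet.biUnion fun Y _ =>
    (Y.2.finite_equivariantHom hF).image LinearMap.range).subset fun X hX => ?_
  obtain ⟨Y, hY, f, hf, hfX⟩ := hX.exists_mem_range_eq t (ht X hX)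
  exact Set.mem_biUnion hY ⟨f, hf, hfX⟩

/-- A special submodule has only finitely many covers among special submodules. -/
theorem finite_setOf_covBy (L : {L : Submodule R N // IsSpecial F L}) :
    {M | L ⋖ M}.Finite := by
  obtain ⟨L, hL⟩ := L
  let G := quotientMap F L hL.stable
  have hfin := finite_isMinimalStable (hL.injective_quotientMap)
  have hcomap : ∀ X : Submodule R (N ⧸ L), IsFStable G X → IsFStable F (X.comap L.mkQ) :=
    fun X hX x hx => hX _ hx
  -- Covers are recovered as nil closures of preimages of minimal stable submodules; the default `⊥`
  -- never matters, as those are stable.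
  let c : Submodule R (N ⧸ L) → Submodule R N := fun X =>
    open Classical in if hX : IsFStable G X then nilClosure F _ (hcomap X hX) else ⊥
  refine Set.Finite.of_finite_image (f := Subtype.val) ((hfin.image c).subset ?_)
    Subtype.val_injective.injOn
  rintro _ ⟨⟨M, hM⟩, hLM, rfl⟩
  have hlt : L < M := hLM.lt
  -- The nil closure of a minimal such `X` is special and lies strictly above `L` and below `M`, so
  -- it equals the cover `M`.
  obtain ⟨X, ⟨hX, hLX, hXM⟩, hmin⟩ := IsArtinian.set_has_minimal (R := R)
    {X : Submodule R N | IsFStable F X ∧ L < X ∧ X ≤ M} ⟨M, hM.stable, hlt, le_rfl⟩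
  have hXc : (X.map L.mkQ).comap L.mkQ = X := by
    rw [Submodule.comap_map_mkQ, sup_eq_right.2 hLX.le]
  have hbot : ∀ Y : Submodule R N, Y.map L.mkQ = ⊥ ↔ Y ≤ L := fun Y => by
    rw [← LinearMap.le_ker_iff_map, Submodule.ker_mkQ]
  have hXst : IsFStable G (X.map L.mkQ) := by
    rintro _ ⟨x, hx, rfl⟩
    exact ⟨F x, hX x hx, rfl⟩
  refine ⟨X.map L.mkQ, ⟨hXst, fun h0 => ?_, fun Y hY hYX hY0 => ?_⟩, ?_⟩
  · exact hLX.not_ge ((hbot X).1 h0)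
  · have hle : Y.comap L.mkQ ≤ X := hXc ▸ Submodule.comap_mono hYX
    have hLY : L ≤ Y.comap L.mkQ := Submodule.le_comap_mkQ L Y
    have hne : L ≠ Y.comap L.mkQ := fun heq => hY0 (by
      rw [← Submodule.map_comap_eq_of_surjective L.mkQ_surjective Y, ← heq, hbot])
    have := hmin _ ⟨hcomap Y hY, lt_of_le_of_ne hLY hne, hle.trans hXM⟩
    rw [← eq_of_le_of_not_lt hle this, Submodule.map_comap_eq_of_surjective L.mkQ_surjective]
  · have hst := hcomap _ hXst
    simp only [c, dif_pos hXst]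
    have h1 : nilClosure F _ hst ≤ M := nilClosure_le _ hM (hXc.le.trans hXM)
    have h2 : L < nilClosure F _ hst := hLX.trans_le (hXc.ge.trans (le_nilClosure _))
    by_contra hne
    exact hLM.2 (c := ⟨_, isSpecial_nilClosure hst⟩) h2
      (show nilClosure F _ hst < M from lt_of_le_of_ne h1 hne)

/-- An Artinian module with a `p`-linear map over a complete Noetherian local ring has only
finitely many special submodules. -/
theorem finite_isSpecial (F : N →ₛₗ[frobenius R p] N) :
    Finite {L : Submodule R N // IsSpecial F L} := by
  have hgt := wellFounded_gt_isSpecial F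
  have hlt : WellFoundedLT {L : Submodule R N // IsSpecial F L} :=
    ⟨InvImage.wf Subtype.val (wellFounded_lt (α := Submodule R N))⟩
  -- Induction from the top, by ACC: DCC puts a cover of `L` below every larger special submodule,
  -- and there are finitely many covers.
  have hfin : ∀ L : {L : Submodule R N // IsSpecial F L}, (Set.Ici L).Finite := by
    intro L
    induction L using WellFoundedGT.induction with
    | _ L ih =>
      refine ((Set.finite_singleton L).union ((finite_setOf_covBy L).biUnion
        fun M hM => ih M hM.lt)).subset fun M hM => ?_
      rcases (Set.mem_Ici.1 hM).eq_or_lt with rfl | hlt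
      · exact Or.inl rfl
      · obtain ⟨C, hC, hCM⟩ := exists_covBy_le_of_lt hlt
        exact Or.inr (Set.mem_biUnion hC hCM)
  -- The nil closure of `0` is the least special submodule.
  have hbot := hfin ⟨_, isSpecial_nilClosure (IsFStable.bot (F := F))⟩
  rw [← Set.finite_univ_iff]
  exact hbot.subset fun M _ => Set.mem_Ici.2 
    (show _ ≤ M.1 from nilClosure_le IsFStable.bot M.2 bot_le)

/-- The iterates of `F` carrying an element into a stable submodule can be chosen uniformly. -/
theorem exists_iterate_mem_of_mem_nilClosure {L : Submodule R N} (hL : IsFStable F L) :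
    ∃ e, ∀ x ∈ nilClosure F L hL, F^[e] x ∈ L := by
  obtain ⟨e, he⟩ := exists_iterateKer_le (quotientMap F L hL)
  have hiter : ∀ n x, (quotientMap F L hL)^[n] (Submodule.Quotient.mk x) =
      Submodule.Quotient.mk (F^[n] x) := by
    intro n x
    induction n generalizing x with
    | zero => rfl
    | succ n ih => exact ih (F x)
  refine ⟨e, fun x ⟨n, hn⟩ => ?_⟩
  have h1 : Submodule.Quotient.mk x ∈ iterateKer (quotientMap F L hL) n := by
    rw [mem_iterateKer, hiter, Submodule.Quotient.mk_eq_zero]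
    exact hn
  have h2 := he n h1
  rwa [mem_iterateKer, hiter, Submodule.Quotient.mk_eq_zero] at h2

theorem nilEquiv_of_nilClosure_eq {P Q : FStableSubmodule F}
    (h : nilClosure F P.1 P.2 = nilClosure F Q.1 Q.2) : NilEquiv F P Q := by
  rw [nilEquiv_iff]
  obtain ⟨a, ha⟩ := exists_iterate_mem_of_mem_nilClosure P.2
  obtain ⟨b, hb⟩ := exists_iterate_mem_of_mem_nilClosure Q.2
  exact ⟨⟨b, fun x hx => hb x (h ▸ le_nilClosure P.2 hx)⟩,
    ⟨a, fun x hx => ha x (h ▸ le_nilClosure Q.2 hx)⟩⟩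

/-- Up to nilpotent action, an Artinian module with a `p`-linear map over a complete Noetherian
local ring has only finitely many stable submodules. -/
theorem finite_quotient_nilSetoid (F : N →ₛₗ[frobenius R p] N) :
    Finite (Quotient (nilSetoid F)) := by
  have := finite_isSpecial F
  refine Finite.of_surjective (fun L : {L : Submodule R N // IsSpecial F L} =>
    (Quotient.mk (nilSetoid F) ⟨L.1, L.2.stable⟩ : Quotient (nilSetoid F))) fun q => ?_
  obtain ⟨P, rfl⟩ := Quotient.exists_rep q
  refine ⟨⟨nilClosure F P.1 P.2, isSpecial_nilClosure P.2⟩, Quotient.sound ?_⟩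
  exact nilEquiv_of_nilClosure_eq (le_antisymm
    (nilClosure_le _ (isSpecial_nilClosure P.2) le_rfl) (le_nilClosure _))

theorem exists_nilClosure_eq_of_monotone {P : ℕ → FStableSubmodule F} (hP : Monotone P) :
    ∃ n, ∀ m, n ≤ m → nilClosure F (P m).1 (P m).2 = nilClosure F (P n).1 (P n).2 := by
  have := wellFounded_gt_isSpecial F
  obtain ⟨n, hn⟩ := WellFoundedGT.monotone_chain_condition
    (α := {L : Submodule R N // IsSpecial F L})
    ⟨fun n => ⟨nilClosure F (P n).1 (P n).2, isSpecial_nilClosure _⟩, fun a b hab =>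
      nilClosure_le (P a).2 (isSpecial_nilClosure (P b).2)
        ((show (P a).1 ≤ (P b).1 from hP hab).trans (le_nilClosure (P b).2))⟩
  exact ⟨n, fun m hm => (congr_arg Subtype.val (hn m hm)).symm⟩

/-- Upwards, the nil closures stabilize by ACC for special submodules; downwards, the chain itself
stabilizes because `N` is Artinian. -/
theorem exists_nilpotentQuotient_of_monotone {P : ℤ → FStableSubmodule F} (hP : Monotone P) :
    ∃ n : ℤ, ∀ i : ℤ, n ≤ |i| → NilpotentQuotient F (P i) (P (i + 1)) := by
  obtain ⟨n, hn⟩ := exists_nilClosure_eq_of_monotone (P := fun k : ℕ => P k)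
    fun a b hab => hP (by exact_mod_cast hab)
  obtain ⟨m, hm⟩ := IsArtinian.monotone_stabilizes (R := R) (M := N)
    ⟨fun k : ℕ => OrderDual.toDual (P (-k)).1, fun a b hab =>
      show (P (-b)).1 ≤ (P (-a)).1 from hP (by omega)⟩
  have hm : ∀ k, m ≤ k → (P (-m)).1 = (P (-k)).1 := hm
  -- For `i = -(k + 1)` the step compares indices `-(k + 1)` and `-k`, so `k ≥ m`, that is `|i| ≥ m
  -- + 1`, is needed.
  refine ⟨max n (m + 1), fun i hi => ?_⟩
  rcases le_or_gt 0 i with h0 | h0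
  · rw [abs_of_nonneg h0] at hi
    lift i to ℕ using h0
    have h1 := (hn (i + 1) (by omega)).trans (hn i (by omega)).symm
    simp only [Nat.cast_add, Nat.cast_one] at h1
    rw [nilpotentQuotient_iff]
    exact ((nilEquiv_iff F _ _).1 (nilEquiv_of_nilClosure_eq h1)).1
  · rw [abs_of_neg h0] at hi
    obtain ⟨k, rfl⟩ : ∃ k : ℕ, i = -(k + 1 : ℕ) := ⟨(-i - 1).toNat, by omega⟩
    have h1 := (hm (k + 1) (by omega)).symm.trans (hm k (by omega))
    rw [nilpotentQuotient_iff]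
    refine ⟨0, fun x hx => ?_⟩
    rw [Function.iterate_zero, id, h1]
    convert hx using 3
    omega

end FrobeniusAction

theorem mainTheorem11 {R : Type*} [CommRing R] [IsNoetherianRing R] [IsLocalRing R]
    [IsAdicComplete (IsLocalRing.maximalIdeal R) R]
    (p : ℕ) [Fact p.Prime] [CharP R p] (hR : FrobeniusAction.IsFFinite R p)
    {N : Type*} [AddCommGroup N] [Module R N] [IsArtinian R N]
    (F : N →ₛₗ[frobenius R p] N) :
    (Monotone (FrobeniusAction.iterateKer F) ∧
      ∃ n : ℕ, ∀ m : ℕ, n ≤ m →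
        FrobeniusAction.iterateKer F m = FrobeniusAction.iterateKer F n) ∧
    (∀ P : ℤ → FrobeniusAction.FStableSubmodule F, Monotone P →
      ∃ n : ℤ, ∀ i : ℤ, n ≤ |i| →
        FrobeniusAction.NilpotentQuotient F (P i) (P (i + 1))) ∧
    (Finite (Quotient (FrobeniusAction.nilSetoid F)) ∧
      {P : FrobeniusAction.FStableSubmodule F |
        Function.Injective (FrobeniusAction.quotientMap F P.1 P.2)}.Finite) := by
  have hspecial := FrobeniusAction.finite_isSpecial F
  obtain ⟨e, he⟩ := FrobeniusAction.exists_iterateKer_le F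
  have hmono := FrobeniusAction.iterateKer_monotone F
  refine ⟨⟨hmono, e, fun m hm => le_antisymm (he m) (hmono hm)⟩,
    fun P hP => FrobeniusAction.exists_nilpotentQuotient_of_monotone hP,
    FrobeniusAction.finite_quotient_nilSetoid F, ?_⟩
  let g : {P : FrobeniusAction.FStableSubmodule F |
      Function.Injective (FrobeniusAction.quotientMap F P.1 P.2)} →
      {L : Submodule R N // FrobeniusAction.IsSpecial F L} := fun P =>
    ⟨P.1.1, FrobeniusAction.isSpecial_of_injective_quotientMap P.1.2 P.2⟩
  refine Set.finite_coe_iff.1 (Finite.of_injective g fun P Q h => ?_)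
  have h' : P.1.1 = Q.1.1 := Subtype.mk.inj h
  exact Subtype.ext (Subtype.ext h')
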